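/- Let $n\ge 1$ and let $\xi_n=\ker(\cos(2\pi nz)\,dx+\sin(2\pi nz)\,dy)$ on $T^3=\mathbb R^3/\mathbb Z^3$, oriented by its normal field $(\cos 2\pi nz,\sin 2\pi nz,0)$. A knot in $T^3$ is a smooth embedding of the circle $\mathbb R/\mathbb Z$. It is quasilinear if it is isotopic in $T^3$ to a knot that lifts to a straight line in $\mathbb R^3$. Let $\alpha$ be a Legendrian knot with lift $\tilde\alpha:\mathbb R\to\mathbb R^3$ satisfying $\tilde\alpha(t+1)=\tilde\alpha(t)+(p,q,r)$ for all $t$, where $(p,q,r)\neq 0$. A covering Seifert surface for $\alpha$ is a connected, orientable, properly embedded smooth surface $\Sigma\subset\mathbb R^3$ with $\partial\Sigma=\tilde\alpha(\mathbb R)$, invariant under translation by $(p,q,r)$, which coincides with an affine half-plane outside a $\delta$-neighbourhood of the boundary line of that half-plane, for some $\delta>0$. Put $\hat\Sigma=\Sigma/\mathbb Z(p,q,r)$. The Thurston–Bennequin invariant $tb(\alpha)$ is the number of rotations, in one circuit of $\alpha$, of a unit field tangent to $\xi_n$ and orthogonal to $\tilde\alpha$ relative to the inward unit field tangent to $\Sigma$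 and orthogonal to $\tilde\alpha$; here the normal planes of $\tilde\alpha$ are oriented by the orientations of $\alpha$ and $\mathbb R^3$. The rotation number $r(\alpha)$ is the number of rotations in $\xi_n$, in one circuit, of $\tilde\alpha'$ relative to a nowhere zero $(p,q,r)$-periodic section $Z$ of $\xi_n$ over $\Sigma$ that is tangent to $P$ along an affine half-plane $P\subset\Sigma$. Proposition. For every $n\ge1$ and every $(p,q,r)\in\mathbb Z^3$ with $\gcd(p,q,r)=1$ there is a quasilinear Legendrian knot $\alpha$ in $(T^3,\xi_n)$ with a lift $\tilde\alpha$ such that $\tilde\alpha(t+1)=\tilde\alpha(t)+(p,q,r)$ for all $t$, and a covering Seifert surface $\Sigma$ for $\alpha$, such that, with the invariants computed from $\Sigma$, $$tb(\alpha)+r(\alpha)=-\chi(\hat\Sigma)+|r|\,n ,$$ and more precisely $r(\alpha)=0$, $tb(\alpha)=|r|\,n$ and $\chi(\hat\Sigma)=0$. -/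

import Mathlib

noncomputable section

/-- Euclidean 3-space, the universal cover of the 3-torus. -/
abbrev E3 : Type := EuclideanSpace ℝ (Fin 3)

/-- The 3-torus `ℝ³ / ℤ³`. -/
abbrev Torus3 : Type := Fin 3 → UnitAddCircle

/-- The universal covering map `ℝ³ → T³`. -/
def torusProj (x : E3) : Torus3 := fun i => ((x i : ℝ) : UnitAddCircle)

/-- The integer vector `(p, q, r)` as an element of `ℝ³`. -/
def intVec (p q r : ℤ) : E3 := !₂[(p : ℝ), (q : ℝ), (r : ℝ)]

/-! ### Knots in the torus, isotopy, quasilinear knots -/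

/-- `γ : ℝ → ℝ³` is a (smooth) lift of the closed curve `α : ℝ/ℤ → T³`. -/
def IsLift (γ : ℝ → E3) (α : UnitAddCircle → Torus3) : Prop :=
  ContDiff ℝ (⊤ : ℕ∞) γ ∧ ∀ t : ℝ, torusProj (γ t) = α (t : UnitAddCircle)

/-- A knot in `T³`: a smooth embedding of the circle `ℝ/ℤ`. As the circle is compact, this is an
injective map that is a smooth immersion; both can be read off from a lift. -/
def IsTorusKnot (α : UnitAddCircle → Torus3) : Prop :=
  Function.Injective α ∧ ∃ γ : ℝ → E3, IsLift γ α ∧ ∀ t, deriv γ t ≠ 0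

/-- Smooth isotopy of knots in `T³`: a smooth one-parameter family of knots `κ s`, `0 ≤ s ≤ 1`
(smoothness in both variables is smoothness of the family of lifts `H s`). -/
def KnotIsotopic (α β : UnitAddCircle → Torus3) : Prop :=
  ∃ (κ : ℝ → UnitAddCircle → Torus3) (H : ℝ → ℝ → E3),
    ContDiff ℝ (⊤ : ℕ∞) (fun u : ℝ × ℝ => H u.1 u.2) ∧
    (∀ s ∈ Set.Icc (0 : ℝ) 1, IsTorusKnot (κ s) ∧ IsLift (H s) (κ s)) ∧
    κ 0 = α ∧ κ 1 = β

/-- `α` is quasilinear: it is isotopic in `T³` to a knot that lifts to a straight line of `ℝ³`. -/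
def IsQuasilinear (α : UnitAddCircle → Torus3) : Prop :=
  ∃ β : UnitAddCircle → Torus3, IsTorusKnot β ∧
    (∃ γ : ℝ → E3, IsLift γ β ∧
      ∃ a w : E3, w ≠ 0 ∧ Set.range γ = Set.range (fun s : ℝ => a + s • w)) ∧
    KnotIsotopic α β

/-! ### The contact structure `ξ_n` -/

/-- The 1-form `cos(2πnz) dx + sin(2πnz) dy` at the point `x` (lifted to `ℝ³`). -/
def contactForm (n : ℕ) (x : E3) : E3 →ₗ[ℝ] ℝ :=
  Real.cos (2 * Real.pi * n * x 2) • EuclideanSpace.projₗ (𝕜 := ℝ) (0 : Fin 3) +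
    Real.sin (2 * Real.pi * n * x 2) • EuclideanSpace.projₗ (𝕜 := ℝ) (1 : Fin 3)

/-- The plane of the (lifted) contact structure `ξ_n` at `x`. -/
def contactPlane (n : ℕ) (x : E3) : Submodule ℝ E3 := LinearMap.ker (contactForm n x)

/-- The unit normal `(cos(2πnz), sin(2πnz), 0)` of `ξ_n`, which orients `ξ_n`: a basis `(u, v)` of
the plane is positive when `(normal, u, v)` is a positive basis of `ℝ³`. -/
def contactNormal (n : ℕ) (x : E3) : E3 :=
  !₂[Real.cos (2 * Real.pi * n * x 2), Real.sin (2 * Real.pi * n * x 2), 0]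

/-- `α` is Legendrian for `ξ_n`: it is everywhere tangent to `ξ_n`. As `ξ_n` is invariant under
`ℤ³`, it does not matter which lift is used. -/
def IsLegendrian (n : ℕ) (α : UnitAddCircle → Torus3) : Prop :=
  ∃ γ : ℝ → E3, IsLift γ α ∧ ∀ t, deriv γ t ∈ contactPlane n (γ t)

/-! ### Covering Seifert surfaces -/

/-- `φ` is a smooth chart of `ℝ³`, i.e. a diffeomorphism between open subsets of `ℝ³`. -/
def IsSmoothChart (φ : OpenPartialHomeomorph E3 E3) : Prop :=
  ContDiffOn ℝ (⊤ : ℕ∞) φ φ.source ∧ ContDiffOn ℝ (⊤ : ℕ∞) φ.symm φ.target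

/-- `S` is a smoothly embedded surface with boundary in `ℝ³`, and its boundary is `B`: in suitable
smooth charts of `ℝ³`, `S` is the plane `{y₂ = 0}` near its points outside `B`, and it is
the half-plane `{y₂ = 0, y₁ ≥ 0}` near the points of `B`, which lie on the edge `y₁ = 0`. -/
def IsSmoothSurface (S B : Set E3) : Prop :=
  B ⊆ S ∧
  (∀ x ∈ S \ B, ∃ φ : OpenPartialHomeomorph E3 E3, IsSmoothChart φ ∧ x ∈ φ.source ∧
    ∀ y ∈ φ.source, y ∈ S ↔ φ y 2 = 0) ∧
  (∀ x ∈ B, ∃ φ : OpenPartialHomeomorph E3 E3, IsSmoothChart φ ∧ x ∈ φ.source ∧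
    φ x 1 = 0 ∧ ∀ y ∈ φ.source, y ∈ S ↔ (φ y 2 = 0 ∧ 0 ≤ φ y 1))

/-- A surface in `ℝ³` is orientable if it has a continuous nowhere zero normal field. (The tangent
plane at `x` is the tangent cone `tangentConeAt ℝ S x`, also at the points of the boundary.) -/
def IsOrientableSurface (S : Set E3) : Prop :=
  ∃ N : E3 → E3, ContinuousOn N S ∧
    ∀ x ∈ S, N x ≠ 0 ∧ ∀ w ∈ tangentConeAt ℝ S x, inner ℝ (N x) w = 0

/-- The affine half-plane bounded by the line `a + ℝ e`, on the side of `f`. -/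
def affineHalfPlane (a e f : E3) : Set E3 :=
  {x | ∃ s u : ℝ, 0 ≤ u ∧ x = a + s • e + u • f}

/-- `S` is a covering Seifert surface for the lift `γ` with period `v` of a knot in `T³`. -/
structure IsCoveringSeifertSurface (γ : ℝ → E3) (v : E3) (S : Set E3) : Prop where
  connected : IsConnected S
  smooth : IsSmoothSurface S (Set.range γ)
  orientable : IsOrientableSurface S
  /-- An embedded surface is properly embedded if and only if it is closed. -/
  proper : IsClosed S
  periodic : ∀ x : E3, x + v ∈ S ↔ x ∈ S
  /-- `S` agrees with an affine half-plane outside a `δ`-neighbourhood of its boundary line. -/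
  halfPlane : ∃ (a e f : E3) (δ : ℝ), LinearIndependent ℝ ![e, f] ∧ 0 < δ ∧
    S \ Metric.thickening δ (Set.range (fun s : ℝ => a + s • e)) =
      affineHalfPlane a e f \ Metric.thickening δ (Set.range (fun s : ℝ => a + s • e))

/-- The generalized Seifert surface `S / ℤv`, as a subspace of `ℝ³ / ℤv`. -/
def seifertQuotient (v : E3) (S : Set E3) : Set (E3 ⧸ AddSubgroup.zmultiples v) :=
  (QuotientAddGroup.mk : E3 → E3 ⧸ AddSubgroup.zmultiples v) '' S

/-- The space `X` has Euler characteristic `k`: it is homotopy equivalent to a finite CW complex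
whose alternating number of cells is `k`. -/
def HasEulerCharacteristic (X : Type) [TopologicalSpace X] (k : ℤ) : Prop :=
  ∃ (Y : Type) (_ : TopologicalSpace Y) (_ : T2Space Y)
    (_ : Topology.CWComplex (Set.univ : Set Y)),
    Topology.RelCWComplex.Finite (Set.univ : Set Y) ∧
    Nonempty (ContinuousMap.HomotopyEquiv X Y) ∧
    k = ∑ᶠ m : ℕ, (-1 : ℤ) ^ m * (Nat.card (Topology.RelCWComplex.cell (Set.univ : Set Y) m) : ℤ)

/-! ### Rotation numbers and the two invariants -/

/-- The cross product of `ℝ³`. -/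
def cross3 (u w : E3) : E3 := WithLp.toLp 2 (crossProduct (WithLp.ofLp u) (WithLp.ofLp w))

/-- In one circuit `t ↦ t + 1`, the field `W` makes `k` turns relative to the field `V` in
the plane field orthogonal to `ν`, where a basis `(u, w)` of the plane is positive
when `(ν, u, w)` is a positive basis of `ℝ³`. For `V t` orthogonal to `ν t`, the vector
`cross3 (‖ν t‖⁻¹ • ν t) (V t)` is `V t` turned by the angle `π / 2`, and `θ` is
a continuous choice of the angle from `V` to `W`. -/
def HasRotationNumber (ν V W : ℝ → E3) (k : ℤ) : Prop :=
  (∀ t, ν t ≠ 0 ∧ V t ≠ 0 ∧ inner ℝ (ν t) (V t) = 0) ∧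
  ∃ θ ρ : ℝ → ℝ, Continuous θ ∧ (∀ t, 0 < ρ t) ∧
    (∀ t, W t = ρ t •
      (Real.cos (θ t) • V t + Real.sin (θ t) • cross3 (‖ν t‖⁻¹ • ν t) (V t))) ∧
    ∀ t, θ (t + 1) = θ t + 2 * Real.pi * k

/-- The Thurston-Bennequin invariant, computed with the covering Seifert surface `S`, of
the Legendrian knot for `ξ_n` with lift `γ` is `k`: this is the number of rotations of the unit
field `Y` tangent to `ξ_n` and orthogonal to the knot, relative to the unit field `X` that is
tangent to `S`, orthogonal to the knot and directed into `S`, in one circuit of the knot.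
The normal planes are oriented by the orientations of the knot and of `ℝ³`. -/
def HasThurstonBennequin (n : ℕ) (γ : ℝ → E3) (S : Set E3) (k : ℤ) : Prop :=
  ∃ X Y : ℝ → E3, Continuous X ∧ Continuous Y ∧
    (∀ t, ‖X t‖ = 1 ∧ inner ℝ (deriv γ t) (X t) = 0 ∧ X t ∈ posTangentConeAt S (γ t)) ∧
    (∀ t, ‖Y t‖ = 1 ∧ inner ℝ (deriv γ t) (Y t) = 0 ∧ Y t ∈ contactPlane n (γ t)) ∧
    HasRotationNumber (deriv γ) X Y k

/-- The rotation (Maslov) number, computed with the covering Seifert surface `S`, of the oriented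
Legendrian knot for `ξ_n` with lift `γ` of period `v` is `k`: this is the number of rotations in
`ξ_n` of the tangent vector of the knot relative to `Z`, in one circuit of the knot, where `Z` is
a nowhere zero `v`-periodic section of `ξ_n` over `S` which is tangent to `P` along an affine
half-plane `P` contained in `S`. -/
def HasMaslovNumber (n : ℕ) (γ : ℝ → E3) (v : E3) (S : Set E3) (k : ℤ) : Prop :=
  ∃ (Z : E3 → E3) (a e f : E3), LinearIndependent ℝ ![e, f] ∧ affineHalfPlane a e f ⊆ S ∧
    ContinuousOn Z S ∧
    (∀ x ∈ S, Z x ≠ 0 ∧ Z x ∈ contactPlane n x ∧ Z (x + v) = Z x) ∧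
    (∀ x ∈ affineHalfPlane a e f, Z x ∈ Submodule.span ℝ {e, f}) ∧
    HasRotationNumber (fun t => contactNormal n (γ t)) (fun t => Z (γ t)) (deriv γ) k

end

/-! The planes of `ξ_n` all contain the vertical direction and turn with the height. Write (p, q) =
c(cos ψ, sin ψ) and use horizontal axes turned by ψ.

If r ≠ 0, let the curve rise with constant speed r, started so that the contact normal at time t has
angle ωt, ω = 2πnr, in the turned axes. A Legendrian velocity must then have horizontal part along
(sin ωt, -cos ωt). The multiple 2c sin ωt of this vector has mean (c, 0), so integration gives a
line of direction (p, q, r) plus a circular horizontal displacement of radius |c/(2ω)|. The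
displacement depends only on the height modulo 1, hence shrinking it to zero never creates a double
point in the torus (`IsHorizontalWiggle.isQuasilinear`). If r = 0, a straight line at a height where
the contact plane contains (p, q, 0) is already Legendrian.

The surface is a half-plane whose edge is sheared onto the curve by a compactly controlled bump. It
is the image of a standard half-plane under a diffeomorphism of space conjugating a unit translation
to the period (`IsPeriodicDiffeo`), so smoothness, orientability and closedness are transported, and
the quotient retracts onto its boundary circle, with Euler characteristic 0.

Rotation numbers come from `hasRotationNumber_of_slit`: a field that never points opposite to a
model direction turns as often as the model. For r ≠ 0 the inward field and the contact framing are
orthogonal projections, to the normal plane of the curve, of a fixed horizontal vector and of the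
horizontal contact direction. The latter makes nr turns, and the projection of the horizontal plane
preserves orientation exactly when r > 0, so the count is |r|n
(`hasRotationNumber_contact_framing`). A constant vertical section Z trivializes `ξ_n`, and the
velocity has a constant positive component along it, so the rotation number is 0. For r = 0 all the
fields involved are constant. -/

noncomputable section

/-! ### The circle as a finite CW complex -/

/-- The cells of the decomposition of the circle into one vertex and one edge. -/
def circleCell : ℕ → Type
  | 0 => Unit
  | 1 => Unit
  | _ => Empty

/-- The characteristic map of the edge of the circle. -/
def circleEdge : PartialEquiv (Fin 1 → ℝ) UnitAddCircle where
  toFun x := ((x 0 / 2 : ℝ) : UnitAddCircle)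
  invFun y := fun _ => 2 * (AddCircle.equivIco (1 : ℝ) (-1 / 2) y : ℝ)
  source := Metric.ball 0 1
  target := {((-1 / 2 : ℝ) : UnitAddCircle)}ᶜ
  map_source' x hx := by
    have h : |x 0| < 1 := by simpa [Pi.norm_def] using hx
    rw [abs_lt] at h
    intro h'
    have := (AddCircle.coe_eq_coe_iff_of_mem_Ico (p := (1 : ℝ)) (a := -1 / 2)
      ⟨by linarith, by linarith⟩ ⟨by linarith, by linarith⟩).1 h'
    linarith
  map_target' y hy := by
    have h := (AddCircle.equivIco (1 : ℝ) (-1 / 2) y).2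
    have hne : (AddCircle.equivIco (1 : ℝ) (-1 / 2) y : ℝ) ≠ -1 / 2 := by
      intro h'
      apply hy
      rw [Set.mem_singleton_iff, ← h', AddCircle.coe_equivIco]
    have h2 : |2 * (AddCircle.equivIco (1 : ℝ) (-1 / 2) y : ℝ)| < 1 := by
      rw [abs_lt]
      have := lt_of_le_of_ne h.1 hne.symm
      constructor <;> linarith [h.2]
    rw [mem_ball_zero_iff, pi_norm_lt_iff one_pos]
    exact fun _ => h2
  left_inv' x hx := by
    have h : |x 0| < 1 := by simpa [Pi.norm_def] using hx
    rw [abs_lt] at h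
    funext i
    rw [AddCircle.equivIco_coe_of_mem (p := (1 : ℝ)) ⟨by linarith, by linarith⟩,
      Fin.fin_one_eq_zero i]
    ring
  right_inv' y _ := by
    simp [mul_div_cancel_left₀]

theorem range_circleEdge_closedBall :
    circleEdge '' Metric.closedBall 0 1 = Set.univ := by
  refine Set.eq_univ_of_forall fun y => ?_
  refine ⟨fun _ => 2 * (AddCircle.equivIco (1 : ℝ) (-1 / 2) y : ℝ), ?_, ?_⟩
  · have h := (AddCircle.equivIco (1 : ℝ) (-1 / 2) y).2
    rw [mem_closedBall_zero_iff, pi_norm_le_iff_of_nonneg zero_le_one]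
    intro _
    rw [Real.norm_eq_abs, abs_le]
    constructor <;> linarith [h.1, h.2]
  · simp [circleEdge]

/-- The characteristic maps of the cells of the circle. -/
def circleCellMap : (m : ℕ) → circleCell m → PartialEquiv (Fin m → ℝ) UnitAddCircle
  | 0, _ => PartialEquiv.single 0 ((-1 / 2 : ℝ) : UnitAddCircle)
  | 1, _ => circleEdge
  | _ + 2, i => i.elim

theorem isEmpty_circleCell {m : ℕ} (hm : 2 ≤ m) : IsEmpty (circleCell m) := by
  obtain ⟨j, rfl⟩ := Nat.exists_eq_add_of_le' hm
  exact inferInstanceAs (IsEmpty Empty)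

/-- The circle as a CW complex with one vertex and one edge. -/
@[reducible] def circleCWComplex : Topology.CWComplex (Set.univ : Set UnitAddCircle) :=
  Topology.CWComplex.mkFinite Set.univ circleCell circleCellMap
    (Filter.eventually_atTop.2 ⟨2, fun _ => isEmpty_circleCell⟩)
    (fun m => match m with
      | 0 => inferInstanceAs (Finite Unit)
      | 1 => inferInstanceAs (Finite Unit)
      | _ + 2 => inferInstanceAs (Finite Empty))
    (fun m i => match m, i with
      | 0, _ => by
        ext x
        simp [circleCellMap, Subsingleton.elim x 0]
      | 1, _ => rfl)
    (fun m i => match m, i with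
      | 0, _ => continuousOn_const
      | 1, _ => by
        refine Continuous.continuousOn ?_
        exact (AddCircle.continuous_mk' 1).comp ((continuous_apply 0).div_const 2))
    (fun m i => match m, i with
      | 0, _ => continuousOn_const
      | 1, _ => by
        intro y hy
        refine ContinuousAt.continuousWithinAt ?_
        refine continuousAt_pi.2 fun _ => continuousAt_const.mul ?_
        exact continuousAt_subtype_val.comp (AddCircle.continuousAt_equivIco (1 : ℝ) (-1 / 2) hy))
    (by
      have key : Disjoint (circleCellMap 0 () '' Metric.ball 0 1)
          (circleCellMap 1 () '' Metric.ball 0 1) := by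
        rw [Set.disjoint_left]
        rintro _ ⟨x, -, rfl⟩ ⟨y, hy, h⟩
        exact circleEdge.map_source hy h
      rintro ⟨m, i⟩ - ⟨m', i'⟩ - hne
      match m, i, m', i' with
      | 0, _, 0, _ => exact absurd rfl hne
      | 1, _, 1, _ => exact absurd rfl hne
      | 0, _, 1, _ => exact key
      | 1, _, 0, _ => exact key.symm)
    (fun m i => match m, i with
      | 0, _ => by
        intro x hx
        rw [mem_sphere_zero_iff_norm, Subsingleton.elim x 0, norm_zero] at hx
        exact absurd hx zero_ne_one
      | 1, _ => by
        intro x hx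
        have h : |x 0| = 1 := by simpa [Pi.norm_def] using hx
        refine Set.mem_iUnion₂.2 ⟨0, one_pos, Set.mem_iUnion.2 ⟨(), 0, by simp, ?_⟩⟩
        change ((-1 / 2 : ℝ) : UnitAddCircle) = ((x 0 / 2 : ℝ) : UnitAddCircle)
        rcases abs_eq zero_le_one |>.1 h with h | h <;> rw [h]
        -- The other end of the edge, 1/2, is the vertex -1/2 moved by one period.
        rw [← AddCircle.coe_add_period (1 : ℝ) (-1 / 2)]
        norm_num)
    (by
      refine Set.eq_univ_of_univ_subset ?_
      rw [← range_circleEdge_closedBall]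
      exact fun y hy => Set.mem_iUnion₂.2 ⟨1, (), hy⟩)

theorem hasEulerCharacteristic_of_homotopyEquiv_circle {X : Type} [TopologicalSpace X]
    (h : ContinuousMap.HomotopyEquiv X UnitAddCircle) : HasEulerCharacteristic X 0 := by
  refine ⟨UnitAddCircle, inferInstance, inferInstance, circleCWComplex, ?_, ⟨h⟩, ?_⟩
  · exact Topology.CWComplex.finite_mkFinite ..
  · change (0 : ℤ) = ∑ᶠ m : ℕ, (-1 : ℤ) ^ m * (Nat.card (circleCell m) : ℤ)
    rw [finsum_eq_sum_of_support_subset (s := Finset.range 2)]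
    · have h0 : Nat.card (circleCell 0) = 1 := Nat.card_unique (α := Unit)
      have h1 : Nat.card (circleCell 1) = 1 := Nat.card_unique (α := Unit)
      simp [Finset.sum_range_succ, h0, h1]
    · intro m hm
      by_contra h2
      have := isEmpty_circleCell (m := m) (by simpa [Nat.succ_le_iff] using h2)
      exact hm (by simp)

/-! ### Periodic diffeomorphic images of a half-plane -/

/-- A diffeomorphism of `ℝ³` that conjugates the translation by `(1, 0, 0)` to the translation
by `v`. -/
structure IsPeriodicDiffeo (Ψ : E3 ≃ₜ E3) (v : E3) : Prop where
  contDiff : ContDiff ℝ (⊤ : ℕ∞) Ψ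
  contDiff_symm : ContDiff ℝ (⊤ : ℕ∞) Ψ.symm
  map_add : ∀ x, Ψ (x + !₂[1, 0, 0]) = Ψ x + v

/-- The image of the half-plane `{y₂ = 0, y₁ ≥ 0}`. -/
def halfPlaneImage (Ψ : E3 ≃ₜ E3) : Set E3 := {x | Ψ.symm x 2 = 0 ∧ 0 ≤ Ψ.symm x 1}

/-- The image of the line `{y₁ = y₂ = 0}`, with its parametrization. -/
def axisImage (Ψ : E3 ≃ₜ E3) (t : ℝ) : E3 := Ψ !₂[t, 0, 0]

theorem continuous_vec3 {X : Type*} [TopologicalSpace X] {a b c : X → ℝ} (ha : Continuous a)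
    (hb : Continuous b) (hc : Continuous c) : Continuous fun x => (!₂[a x, b x, c x] : E3) := by
  refine (PiLp.continuous_toLp 2 _).comp (continuous_pi fun i => ?_)
  fin_cases i <;> simpa

theorem contDiff_vec3 {X : Type*} [NormedAddCommGroup X] [NormedSpace ℝ X] {a b c : X → ℝ}
    {m : WithTop ℕ∞} (ha : ContDiff ℝ m a)
    (hb : ContDiff ℝ m b) (hc : ContDiff ℝ m c) :
    ContDiff ℝ m fun x => (!₂[a x, b x, c x] : E3) := by
  rw [contDiff_piLp]
  intro i
  fin_cases i <;> simpa

theorem hasDerivAt_vec3 {a b c : ℝ → ℝ} {a' b' c' t : ℝ} (ha : HasDerivAt a a' t)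
    (hb : HasDerivAt b b' t) (hc : HasDerivAt c c' t) :
    HasDerivAt (fun s => (!₂[a s, b s, c s] : E3)) !₂[a', b', c'] t := by
  refine (PiLp.continuousLinearEquiv 2 ℝ fun _ : Fin 3 => ℝ).symm.hasFDerivAt.comp_hasDerivAt t
    (hasDerivAt_pi.2 fun i => ?_)
  fin_cases i <;> simpa

theorem continuous_coord (i : Fin 3) : Continuous fun x : E3 => x i := by fun_prop

theorem contDiff_coord (i : Fin 3) {m : WithTop ℕ∞} : ContDiff ℝ m fun x : E3 => x i :=
  contDiff_piLp_apply ..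

theorem vec3_eta (x : E3) : !₂[x 0, x 1, x 2] = x := by
  ext i
  fin_cases i <;> rfl

theorem mem_halfPlaneImage {Ψ : E3 ≃ₜ E3} {s w : ℝ} (hw : 0 ≤ w) :
    Ψ !₂[s, w, 0] ∈ halfPlaneImage Ψ := by
  simp [halfPlaneImage, hw]

theorem axisImage_mem (Ψ : E3 ≃ₜ E3) (t : ℝ) : axisImage Ψ t ∈ halfPlaneImage Ψ :=
  mem_halfPlaneImage le_rfl

theorem halfPlaneImage_eq_range (Ψ : E3 ≃ₜ E3) :
    halfPlaneImage Ψ = (fun y : ℝ × ℝ => Ψ !₂[y.1, y.2, 0]) '' {y | 0 ≤ y.2} := by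
  ext x
  constructor
  · intro hx
    refine ⟨(Ψ.symm x 0, Ψ.symm x 1), hx.2, ?_⟩
    conv_rhs => rw [← Ψ.apply_symm_apply x, ← vec3_eta (Ψ.symm x)]
    rw [hx.1]
  · rintro ⟨y, hy, rfl⟩
    exact mem_halfPlaneImage hy

theorem isConnected_halfPlaneImage (Ψ : E3 ≃ₜ E3) : IsConnected (halfPlaneImage Ψ) := by
  rw [halfPlaneImage_eq_range]
  refine IsConnected.image ?_ _ (Continuous.continuousOn ?_)
  · refine ⟨⟨(0, 0), le_refl (0 : ℝ)⟩, (Convex.isPreconnected ?_)⟩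
    exact convex_halfSpace_ge (LinearMap.snd ℝ ℝ ℝ).isLinear 0
  · exact Ψ.continuous.comp (continuous_vec3 continuous_fst continuous_snd continuous_const)

theorem isClosed_halfPlaneImage (Ψ : E3 ≃ₜ E3) : IsClosed (halfPlaneImage Ψ) :=
  (isClosed_eq ((continuous_coord 2).comp Ψ.symm.continuous) continuous_const).inter
    (isClosed_le continuous_const ((continuous_coord 1).comp Ψ.symm.continuous))

theorem IsPeriodicDiffeo.symm_add {Ψ : E3 ≃ₜ E3} {v : E3} (h : IsPeriodicDiffeo Ψ v) (x : E3) :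
    Ψ.symm (x + v) = Ψ.symm x + !₂[1, 0, 0] := by
  rw [Ψ.symm_apply_eq, h.map_add, Ψ.apply_symm_apply]

theorem IsPeriodicDiffeo.add_mem_iff {Ψ : E3 ≃ₜ E3} {v : E3} (h : IsPeriodicDiffeo Ψ v) (x : E3) :
    x + v ∈ halfPlaneImage Ψ ↔ x ∈ halfPlaneImage Ψ := by
  simp [halfPlaneImage, h.symm_add]

theorem IsPeriodicDiffeo.isSmoothSurface {Ψ : E3 ≃ₜ E3} {v : E3} (h : IsPeriodicDiffeo Ψ v) :
    IsSmoothSurface (halfPlaneImage Ψ) (Set.range (axisImage Ψ)) := by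
  have hB : ∀ x ∈ halfPlaneImage Ψ, x ∉ Set.range (axisImage Ψ) → 0 < Ψ.symm x 1 := by
    intro x hx hxB
    refine lt_of_le_of_ne hx.2 fun h1 => hxB ⟨Ψ.symm x 0, ?_⟩
    rw [axisImage, ← Ψ.eq_symm_apply, ← vec3_eta (Ψ.symm x), hx.1, ← h1]
    simp
  refine ⟨?_, ?_, ?_⟩
  · rintro _ ⟨t, rfl⟩
    exact axisImage_mem Ψ t
  · rintro x ⟨hx, hxB⟩
    -- Away from the edge the chart is cut down to y₁ > 0, where the inequality defining the
    -- half-plane is automatic.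
    have hopen : IsOpen {y : E3 | 0 < Ψ.symm y 1} :=
      isOpen_lt continuous_const ((continuous_coord 1).comp Ψ.symm.continuous)
    refine ⟨Ψ.symm.toOpenPartialHomeomorph.restrOpen _ hopen, ⟨?_, ?_⟩, ?_, ?_⟩
    · exact h.contDiff_symm.contDiffOn
    · exact h.contDiff.contDiffOn
    · exact ⟨trivial, hB x hx hxB⟩
    · rintro y ⟨-, hy⟩
      exact ⟨fun h => h.1, fun h => ⟨h, le_of_lt hy⟩⟩
  · rintro _ ⟨t, rfl⟩
    refine ⟨Ψ.symm.toOpenPartialHomeomorph, ⟨?_, ?_⟩, trivial, ?_, ?_⟩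
    · exact h.contDiff_symm.contDiffOn
    · exact h.contDiff.contDiffOn
    · simp [axisImage]
    · exact fun y _ => Iff.rfl

/-- The surface lies in a level set of the last coordinate of `Ψ.symm`, so the gradient of that
function is a normal field. -/
theorem IsPeriodicDiffeo.isOrientableSurface {Ψ : E3 ≃ₜ E3} {v : E3} (h : IsPeriodicDiffeo Ψ v) :
    IsOrientableSurface (halfPlaneImage Ψ) := by
  have hF : ContDiff ℝ (⊤ : ℕ∞) fun y => Ψ.symm y 2 := (contDiff_coord 2).comp h.contDiff_symm
  have hd : ∀ x, DifferentiableAt ℝ (fun y => Ψ.symm y 2) x :=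
    fun x => (hF.differentiable (by simp)) x
  refine ⟨fun x => gradient (fun y => Ψ.symm y 2) x, ?_, fun x hx => ⟨?_, ?_⟩⟩
  · exact ((InnerProductSpace.toDual ℝ E3).symm.continuous.comp
      (hF.continuous_fderiv (by simp))).continuousOn
  · intro h0
    have h1 : fderiv ℝ (fun y => Ψ.symm y 2) x = 0 :=
      (LinearIsometryEquiv.map_eq_zero_iff _).1 h0
    -- Along the `Ψ`-image of the third coordinate direction the function grows with slope 1, which
    -- rules out a zero differential.
    have hc : DifferentiableAt ℝ (fun t : ℝ => Ψ (Ψ.symm x + t • !₂[0, 0, 1])) 0 :=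
      (h.contDiff.differentiable (by simp) _).comp (0 : ℝ) (by fun_prop)
    have h2 := HasFDerivAt.comp_hasDerivAt_of_eq (0 : ℝ) (hd x).hasFDerivAt hc.hasDerivAt (by simp)
    rw [h1] at h2
    have h3 : HasDerivAt (fun t : ℝ => Ψ.symm x 2 + t) 1 0 := (hasDerivAt_id 0).const_add _
    refine one_ne_zero (h3.unique (h2.congr_of_eventuallyEq (.of_forall fun t => ?_)))
    simp
  · intro w hw
    have hm := (hd x).hasFDerivAt.hasFDerivWithinAt.mapsTo_tangent_cone hw
    have hsub : (fun y => Ψ.symm y 2) '' halfPlaneImage Ψ ⊆ {0} := by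
      rintro _ ⟨y, hy, rfl⟩
      exact hy.1
    -- The differential carries the tangent cone into that of a single point, which is zero because
    -- the point is isolated.
    have h0 := tangentConeAt_subset_zero (𝕜 := ℝ) (x := Ψ.symm x 2) (s := {0}) ?_
      (tangentConeAt_mono hsub hm)
    · simpa [gradient] using h0
    · rw [accPt_iff_frequently]
      simp +contextual [hx.1]

theorem IsPeriodicDiffeo.mem_posTangentConeAt {Ψ : E3 ≃ₜ E3} {v : E3} (h : IsPeriodicDiffeo Ψ v)
    (t : ℝ) {l m : ℝ} (hm : 0 ≤ m) :
    fderiv ℝ Ψ !₂[t, 0, 0] !₂[l, m, 0] ∈ posTangentConeAt (halfPlaneImage Ψ) (axisImage Ψ t) := by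
  have hd : HasDerivAt (fun s : ℝ => Ψ (!₂[t, 0, 0] + s • !₂[l, m, 0]))
      (fderiv ℝ Ψ !₂[t, 0, 0] !₂[l, m, 0]) 0 := by
    refine HasFDerivAt.comp_hasDerivAt_of_eq (0 : ℝ)
      (h.contDiff.differentiable (by simp) _).hasFDerivAt ?_ (by simp)
    simpa using ((hasDerivAt_id (0 : ℝ)).smul_const (!₂[l, m, 0] : E3)).const_add !₂[t, 0, 0]
  have hs := hd.tendsto_slope_zero_right
  simp only [zero_add, zero_smul, add_zero] at hs
  have hg : Filter.Tendsto (fun s : ℝ => Ψ (!₂[t, 0, 0] + s • !₂[l, m, 0]) - axisImage Ψ t)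
      (nhdsWithin 0 (Set.Ioi 0)) (nhds 0) := by
    have := hd.continuousAt.tendsto.sub_const (axisImage Ψ t)
    simp only [zero_smul, add_zero, axisImage, sub_self] at this
    exact this.mono_left nhdsWithin_le_nhds
  have hpos : ∀ᶠ s : ℝ in nhdsWithin 0 (Set.Ioi 0), 0 < s := self_mem_nhdsWithin
  refine mem_tangentConeAt_of_seq _ (fun s : ℝ => s⁻¹.toNNReal) _ hg ?_ ?_
  · filter_upwards [hpos] with s hs0
    rw [add_sub_cancel]
    have : (!₂[t, 0, 0] + s • !₂[l, m, 0] : E3) = !₂[t + s * l, s * m, 0] := by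
      ext i; fin_cases i <;> simp
    rw [this]
    exact mem_halfPlaneImage (by positivity)
  · refine hs.congr' ?_
    filter_upwards [hpos] with s hs0
    rw [NNReal.smul_def, Real.coe_toNNReal _ (by positivity)]
    rfl

/-- The contraction of `ℝ³` to the image of the axis, at time `1 - τ`. -/
def axisContraction (Ψ : E3 ≃ₜ E3) (τ : ℝ) (x : E3) : E3 :=
  Ψ !₂[Ψ.symm x 0, τ * Ψ.symm x 1, τ * Ψ.symm x 2]

theorem continuous_axisContraction (Ψ : E3 ≃ₜ E3) :
    Continuous fun y : ℝ × E3 => axisContraction Ψ y.1 y.2 := by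
  have h (i : Fin 3) : Continuous fun y : ℝ × E3 => Ψ.symm y.2 i :=
    (continuous_coord i).comp (Ψ.symm.continuous.comp continuous_snd)
  exact Ψ.continuous.comp
    (continuous_vec3 (h 0) (continuous_fst.mul (h 1)) (continuous_fst.mul (h 2)))

theorem IsPeriodicDiffeo.axisContraction_add {Ψ : E3 ≃ₜ E3} {v : E3} (h : IsPeriodicDiffeo Ψ v)
    (τ : ℝ) (x : E3) : axisContraction Ψ τ (x + v) = axisContraction Ψ τ x + v := by
  rw [axisContraction, axisContraction, h.symm_add, ← h.map_add]
  congr 1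
  ext i
  fin_cases i <;> simp

theorem axisContraction_mem {Ψ : E3 ≃ₜ E3} {τ : ℝ} (hτ : 0 ≤ τ) {x : E3}
    (hx : x ∈ halfPlaneImage Ψ) : axisContraction Ψ τ x ∈ halfPlaneImage Ψ := by
  rw [axisContraction, hx.1, mul_zero]
  exact mem_halfPlaneImage (mul_nonneg hτ hx.2)

theorem axisContraction_zero (Ψ : E3 ≃ₜ E3) (x : E3) :
    axisContraction Ψ 0 x = axisImage Ψ (Ψ.symm x 0) := by
  simp [axisContraction, axisImage]

theorem axisContraction_one (Ψ : E3 ≃ₜ E3) (x : E3) : axisContraction Ψ 1 x = x := by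
  rw [axisContraction, one_mul, one_mul, vec3_eta, Ψ.apply_symm_apply]

theorem IsPeriodicDiffeo.axisImage_add_one {Ψ : E3 ≃ₜ E3} {v : E3} (h : IsPeriodicDiffeo Ψ v)
    (t : ℝ) : axisImage Ψ (t + 1) = axisImage Ψ t + v := by
  rw [axisImage, axisImage, ← h.map_add]
  congr 1
  ext i
  fin_cases i <;> simp

theorem continuous_axisImage (Ψ : E3 ≃ₜ E3) : Continuous (axisImage Ψ) :=
  Ψ.continuous.comp (continuous_vec3 continuous_id continuous_const continuous_const)

theorem mk_add_self (v x : E3) :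
    ((x + v : E3) : E3 ⧸ AddSubgroup.zmultiples v) = (x : E3 ⧸ AddSubgroup.zmultiples v) := by
  rw [QuotientAddGroup.eq]
  exact ⟨-1, by simp⟩

/-- Scaling the last two standard coordinates by τ commutes with the period and preserves the
half-plane, so it descends to a deformation retraction onto the quotient of the axis. -/
theorem IsPeriodicDiffeo.homotopyEquiv_circle {Ψ : E3 ≃ₜ E3} {v : E3} (h : IsPeriodicDiffeo Ψ v) :
    Nonempty (ContinuousMap.HomotopyEquiv (seifertQuotient v (halfPlaneImage Ψ))
      UnitAddCircle) := by
  have hp : Function.Periodic (fun x : E3 => ((Ψ.symm x 0 : ℝ) : UnitAddCircle)) v := by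
    intro x
    simp [h.symm_add]
  have hpa : Function.Periodic
      (fun t : ℝ => (axisImage Ψ t : E3 ⧸ AddSubgroup.zmultiples v)) 1 := by
    intro t
    simp only [h.axisImage_add_one, mk_add_self]
  have hpd (τ : ℝ) : Function.Periodic
      (fun x : E3 => (axisContraction Ψ τ x : E3 ⧸ AddSubgroup.zmultiples v)) v := by
    intro x
    simp only [h.axisContraction_add, mk_add_self]
  have hq : IsOpenQuotientMap ((↑) : E3 → E3 ⧸ AddSubgroup.zmultiples v) :=
    QuotientAddGroup.isOpenQuotientMap_mk
  have hcp : Continuous hp.lift := by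
    rw [← hq.continuous_comp_iff]
    exact (AddCircle.continuous_mk' 1).comp ((continuous_coord 0).comp Ψ.symm.continuous)
  have hca : Continuous hpa.lift := by
    rw [← (QuotientAddGroup.isOpenQuotientMap_mk
      (N := AddSubgroup.zmultiples (1 : ℝ))).continuous_comp_iff]
    exact hq.continuous.comp (continuous_axisImage Ψ)
  -- Joint continuity descends because the quotient map is open, so its product with the identity is
  -- again a quotient map.
  have hcd : Continuous fun y : ℝ × (E3 ⧸ AddSubgroup.zmultiples v) => (hpd y.1).lift y.2 := by
    rw [← (IsOpenQuotientMap.id.prodMap hq).continuous_comp_iff]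
    exact hq.continuous.comp (continuous_axisContraction Ψ)
  have hma (y : UnitAddCircle) : hpa.lift y ∈ seifertQuotient v (halfPlaneImage Ψ) := by
    obtain ⟨t, rfl⟩ := QuotientAddGroup.mk_surjective y
    exact ⟨_, axisImage_mem Ψ t, rfl⟩
  have hmd {τ : ℝ} (hτ : 0 ≤ τ) {y : E3 ⧸ AddSubgroup.zmultiples v}
      (hy : y ∈ seifertQuotient v (halfPlaneImage Ψ)) :
      (hpd τ).lift y ∈ seifertQuotient v (halfPlaneImage Ψ) := by
    obtain ⟨x, hx, rfl⟩ := hy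
    exact ⟨_, axisContraction_mem hτ hx, rfl⟩
  refine ⟨⟨⟨fun y => hp.lift y.1, hcp.comp continuous_subtype_val⟩,
    ⟨fun y => ⟨hpa.lift y, hma y⟩, hca.subtype_mk _⟩, ⟨?_⟩, ?_⟩⟩
  · refine ⟨⟨fun y => ⟨(hpd y.1).lift y.2.1, hmd y.1.2.1 y.2.2⟩, ?_⟩, ?_, ?_⟩
    · exact (hcd.comp ((continuous_subtype_val.comp continuous_fst).prodMk
        (continuous_subtype_val.comp continuous_snd))).subtype_mk _
    · rintro ⟨_, x, hx, rfl⟩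
      refine Subtype.ext ?_
      exact congrArg ((↑) : E3 → E3 ⧸ AddSubgroup.zmultiples v) (axisContraction_zero Ψ x)
    · rintro ⟨_, x, hx, rfl⟩
      refine Subtype.ext ?_
      exact congrArg ((↑) : E3 → E3 ⧸ AddSubgroup.zmultiples v) (axisContraction_one Ψ x)
  · have : ContinuousMap.comp (⟨fun y => hp.lift y.1, hcp.comp continuous_subtype_val⟩ :
        C(seifertQuotient v (halfPlaneImage Ψ), UnitAddCircle))
        ⟨fun y => ⟨hpa.lift y, hma y⟩, hca.subtype_mk _⟩ = ContinuousMap.id _ := by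
      ext y
      obtain ⟨t, rfl⟩ := QuotientAddGroup.mk_surjective y
      change ((Ψ.symm (Ψ !₂[t, 0, 0]) 0 : ℝ) : UnitAddCircle) = (t : UnitAddCircle)
      simp
    rw [this]

theorem IsPeriodicDiffeo.hasEulerCharacteristic {Ψ : E3 ≃ₜ E3} {v : E3}
    (h : IsPeriodicDiffeo Ψ v) :
    HasEulerCharacteristic (seifertQuotient v (halfPlaneImage Ψ)) 0 :=
  hasEulerCharacteristic_of_homotopyEquiv_circle h.homotopyEquiv_circle.some

/-! ### Sheared half-planes as covering Seifert surfaces -/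

/-- The shear `(s, w, y) ↦ (s, w + a(s), y + b(s) χ(w + a(s)))` of `ℝ³`. -/
def shear (a b χ : ℝ → ℝ) (ha : Continuous a) (hb : Continuous b) (hχ : Continuous χ) :
    E3 ≃ₜ E3 where
  toFun x := !₂[x 0, x 1 + a (x 0), x 2 + b (x 0) * χ (x 1 + a (x 0))]
  invFun x := !₂[x 0, x 1 - a (x 0), x 2 - b (x 0) * χ (x 1)]
  left_inv x := by ext i; fin_cases i <;> simp
  right_inv x := by ext i; fin_cases i <;> simp
  continuous_toFun := by
    refine continuous_vec3 ?_ ?_ ?_ <;> fun_prop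
  continuous_invFun := by
    refine continuous_vec3 ?_ ?_ ?_ <;> fun_prop

/-- The shear followed by the affine map `x ↦ o + M x`. -/
def affineShear (o : E3) (M : E3 ≃L[ℝ] E3) (a b χ : ℝ → ℝ) (ha : Continuous a)
    (hb : Continuous b) (hχ : Continuous χ) : E3 ≃ₜ E3 :=
  ((shear a b χ ha hb hχ).trans M.toHomeomorph).trans (Homeomorph.addLeft o)

section affineShear

variable {o : E3} {M : E3 ≃L[ℝ] E3} {a b χ : ℝ → ℝ}

theorem affineShear_apply {ha : Continuous a}
    {hb : Continuous b} {hχ : Continuous χ} (x : E3) : affineShear o M a b χ ha hb hχ x =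
      o + M !₂[x 0, x 1 + a (x 0), x 2 + b (x 0) * χ (x 1 + a (x 0))] := rfl

theorem isPeriodicDiffeo_affineShear (o : E3) (M : E3 ≃L[ℝ] E3) (ha : ContDiff ℝ (⊤ : ℕ∞) a)
    (hb : ContDiff ℝ (⊤ : ℕ∞) b)
    (hχ : ContDiff ℝ (⊤ : ℕ∞) χ) (hpa : Function.Periodic a 1) (hpb : Function.Periodic b 1) :
    IsPeriodicDiffeo (affineShear o M a b χ ha.continuous hb.continuous hχ.continuous)
      (M !₂[1, 0, 0]) where
  contDiff := by
    refine contDiff_const.add (M.contDiff.comp ?_)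
    have h (i : Fin 3) := contDiff_coord i (m := (⊤ : ℕ∞))
    exact contDiff_vec3 (h 0) ((h 1).add (ha.comp (h 0)))
      ((h 2).add ((hb.comp (h 0)).mul (hχ.comp ((h 1).add (ha.comp (h 0))))))
  contDiff_symm := by
    have h (i : Fin 3) := contDiff_coord i (m := (⊤ : ℕ∞))
    have h1 : ContDiff ℝ (⊤ : ℕ∞)
        fun x : E3 => (!₂[x 0, x 1 - a (x 0), x 2 - b (x 0) * χ (x 1)] : E3) :=
      contDiff_vec3 (h 0) ((h 1).sub (ha.comp (h 0)))
        ((h 2).sub ((hb.comp (h 0)).mul (hχ.comp (h 1))))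
    exact h1.comp (M.symm.contDiff.comp (contDiff_const.add contDiff_id))
  map_add x := by
    rw [affineShear_apply, affineShear_apply, add_assoc, ← map_add]
    congr 2
    ext i
    fin_cases i <;> simp [hpa (x 0), hpb (x 0)]

theorem mem_halfPlaneImage_affineShear {ha : Continuous a}
    {hb : Continuous b} {hχ : Continuous χ} {x : E3} :
    x ∈ halfPlaneImage (affineShear o M a b χ ha hb hχ) ↔
      ∃ s w, a s ≤ w ∧ x = o + M !₂[s, w, b s * χ w] := by
  rw [halfPlaneImage_eq_range]
  constructor
  · rintro ⟨⟨s, w⟩, hw, rfl⟩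
    exact ⟨s, w + a s, by simpa using hw, by simp [affineShear_apply]⟩
  · rintro ⟨s, w, hw, rfl⟩
    exact ⟨⟨s, w - a s⟩, by simpa using hw, by simp [affineShear_apply]⟩

theorem mem_affineHalfPlane_map {x : E3} :
    x ∈ affineHalfPlane o (M !₂[1, 0, 0]) (M !₂[0, 1, 0]) ↔
      ∃ s w : ℝ, 0 ≤ w ∧ x = o + M !₂[s, w, 0] := by
  refine exists_congr fun s => exists_congr fun w => and_congr Iff.rfl ?_
  rw [add_assoc, ← map_smul, ← map_smul, ← map_add]
  suffices h : (s • !₂[1, 0, 0] + w • !₂[0, 1, 0] : E3) = !₂[s, w, 0] by rw [h]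
  ext i
  fin_cases i <;> simp

theorem linearIndependent_map_pair (M : E3 ≃L[ℝ] E3) :
    LinearIndependent ℝ ![M !₂[1, 0, 0], M !₂[0, 1, 0]] := by
  rw [LinearIndependent.pair_iff]
  intro s w h
  rw [← map_smul, ← map_smul, ← map_add, M.map_eq_zero_iff] at h
  have h0 := congrArg (· 0) h
  have h1 := congrArg (· 1) h
  simp at h0 h1
  exact ⟨h0, h1⟩

/-- The surface is the graph y = b(s) χ(w) over w ≥ a(s) in the frame `M`. Both the displaced edge
and the bump live in w ≤ K + 1, beyond which it is flat. -/
theorem isCoveringSeifertSurface_affineShear (o : E3) (M : E3 ≃L[ℝ] E3)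
    (ha : ContDiff ℝ (⊤ : ℕ∞) a) (hb : ContDiff ℝ (⊤ : ℕ∞) b)
    (hχ : ContDiff ℝ (⊤ : ℕ∞) χ) (hpa : Function.Periodic a 1) (hpb : Function.Periodic b 1)
    {K : ℝ} (haK : ∀ t, |a t| ≤ K) (hbK : ∀ t, |b t| ≤ K) (hχ1 : ∀ w, |χ w| ≤ 1)
    (hχ0 : ∀ w, K + 1 ≤ w → χ w = 0) :
    IsCoveringSeifertSurface
      (axisImage (affineShear o M a b χ ha.continuous hb.continuous hχ.continuous))
      (M !₂[1, 0, 0])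
      (halfPlaneImage (affineShear o M a b χ ha.continuous hb.continuous hχ.continuous)) := by
  have h := isPeriodicDiffeo_affineShear o M ha hb hχ hpa hpb
  have hK : 0 ≤ K := (abs_nonneg _).trans (haK 0)
  refine ⟨isConnected_halfPlaneImage _, h.isSmoothSurface, h.isOrientableSurface,
    isClosed_halfPlaneImage _, h.add_mem_iff, o, M !₂[1, 0, 0], M !₂[0, 1, 0],
    (K + 1) * ‖M !₂[0, 1, 0]‖ + K * ‖M !₂[0, 0, 1]‖ + 1, linearIndependent_map_pair M,
    by positivity, ?_⟩
  -- This fixes δ: everything with |w| ≤ K + 1 and |y| ≤ K lies in the removed neighbourhood,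
  -- leaving only w > K + 1, where χ vanishes.
  have near (s w y : ℝ) (hw : |w| ≤ K + 1) (hy : |y| ≤ K) : o + M !₂[s, w, y] ∈
      Metric.thickening ((K + 1) * ‖M !₂[0, 1, 0]‖ + K * ‖M !₂[0, 0, 1]‖ + 1)
        (Set.range (fun s : ℝ => o + s • M !₂[1, 0, 0])) := by
    rw [Metric.mem_thickening_iff]
    refine ⟨_, ⟨s, rfl⟩, ?_⟩
    have h1 : o + M !₂[s, w, y] - (o + s • M !₂[1, 0, 0]) =
        w • M !₂[0, 1, 0] + y • M !₂[0, 0, 1] := by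
      rw [add_sub_add_left_eq_sub, ← map_smul, ← map_smul, ← map_smul, ← map_add, ← map_sub]
      congr 1
      ext i
      fin_cases i <;> simp
    rw [dist_eq_norm, h1]
    refine ((norm_add_le _ _).trans ?_).trans_lt (lt_add_one _)
    rw [norm_smul, norm_smul]
    gcongr <;> simpa
  ext x
  simp only [Set.mem_sdiff, and_congr_left_iff]
  intro hx
  rw [mem_halfPlaneImage_affineShear, mem_affineHalfPlane_map]
  constructor
  · rintro ⟨s, w, hw, rfl⟩
    by_cases hwK : w ≤ K + 1
    · refine absurd (near s w _ ?_ ?_) hx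
      · exact abs_le.2 ⟨by linarith [(abs_le.1 (haK s)).1], hwK⟩
      · rw [abs_mul]
        exact (mul_le_mul (hbK s) (hχ1 w) (abs_nonneg _) hK).trans (mul_one K).le
    · exact ⟨s, w, by linarith, by rw [hχ0 w (by linarith), mul_zero]⟩
  · rintro ⟨s, w, hw, rfl⟩
    by_cases hwK : w ≤ K + 1
    · exact absurd (near s w 0 (by rwa [abs_of_nonneg hw]) (by simpa)) hx
    · refine ⟨s, w, by linarith [(abs_le.1 (haK s)).2], by rw [hχ0 w (by linarith), mul_zero]⟩

end affineShear

/-! ### Knots obtained by displacing a line horizontally -/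

theorem torusProj_eq_iff {x y : E3} :
    torusProj x = torusProj y ↔ ∀ i, ∃ m : ℤ, x i - y i = m := by
  rw [funext_iff]
  refine forall_congr' fun i => ?_
  rw [torusProj, torusProj, ← sub_eq_zero, ← AddCircle.coe_sub, AddCircle.coe_eq_zero_iff]
  simp [eq_comm]

/-- A smooth displacement `A` of the line of direction `(p, q, r)` that is horizontal and takes
equal values at parameters where the heights on the line agree modulo `1`. -/
structure IsHorizontalWiggle (r : ℤ) (A : ℝ → E3) : Prop where
  contDiff : ContDiff ℝ (⊤ : ℕ∞) A
  horizontal : ∀ t, A t 2 = 0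
  eq_of_int : ∀ (t t' : ℝ) (m : ℤ), (r : ℝ) * (t - t') = m → A t = A t'

/-- The line through `o` of direction `(p, q, r)`, displaced by `A`. -/
def wigglePath (o : E3) (p q r : ℤ) (A : ℝ → E3) (t : ℝ) : E3 := o + t • intVec p q r + A t

theorem intVec_ne_zero {p q r : ℤ} (hprim : Int.gcd (Int.gcd p q : ℤ) r = 1) :
    intVec p q r ≠ 0 := by
  intro h
  have h0 := congrArg (· 0) h
  have h1 := congrArg (· 1) h
  have h2 := congrArg (· 2) h
  simp [intVec] at h0 h1 h2
  simp [h0, h1, h2] at hprim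

/-- Bézout applied twice writes 1 as an integer combination of p, q, r; multiply it by x. -/
theorem exists_int_of_mul_int {p q r : ℤ} (hprim : Int.gcd (Int.gcd p q : ℤ) r = 1) {x : ℝ}
    (hp : ∃ m : ℤ, p * x = m) (hq : ∃ m : ℤ, q * x = m) (hr : ∃ m : ℤ, r * x = m) :
    ∃ m : ℤ, x = m := by
  obtain ⟨i, hi⟩ := hp
  obtain ⟨j, hj⟩ := hq
  obtain ⟨k, hk⟩ := hr
  have h1 := Int.gcd_eq_gcd_ab p q
  have h2 := Int.gcd_eq_gcd_ab (Int.gcd p q) r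
  rw [hprim] at h2
  refine ⟨(i * Int.gcdA p q + j * Int.gcdB p q) * Int.gcdA (Int.gcd p q) r +
    k * Int.gcdB (Int.gcd p q) r, ?_⟩
  have h3 : (1 : ℝ) = (p * Int.gcdA p q + q * Int.gcdB p q) * Int.gcdA (Int.gcd p q) r +
    r * Int.gcdB (Int.gcd p q) r := by
    rw [← Int.cast_mul, ← Int.cast_mul, ← Int.cast_add, ← h1]
    exact_mod_cast h2
  push_cast
  rw [← hi, ← hj, ← hk]
  linear_combination x * h3

namespace IsHorizontalWiggle

variable {o : E3} {p q r : ℤ} {A : ℝ → E3}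

theorem smul (h : IsHorizontalWiggle r A) (c : ℝ) : IsHorizontalWiggle r fun t => c • A t where
  contDiff := h.contDiff.const_smul c
  horizontal t := by simp [h.horizontal t]
  eq_of_int t t' m hm := by rw [h.eq_of_int t t' m hm]

theorem path_add_one (h : IsHorizontalWiggle r A) (o : E3) (p q : ℤ) (t : ℝ) :
    wigglePath o p q r A (t + 1) = wigglePath o p q r A t + intVec p q r := by
  rw [wigglePath, wigglePath, h.eq_of_int (t + 1) t r (by ring), add_smul, one_smul]
  abel

theorem periodic_torusProj (h : IsHorizontalWiggle r A) (o : E3) (p q : ℤ) :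
    Function.Periodic (fun t => torusProj (wigglePath o p q r A t)) (1 : ℝ) := by
  intro t
  change torusProj _ = torusProj _
  rw [h.path_add_one, torusProj_eq_iff]
  intro i
  fin_cases i
  exacts [⟨p, by simp [intVec]⟩, ⟨q, by simp [intVec]⟩, ⟨r, by simp [intVec]⟩]

/-- The closed curve in the torus covered by `wigglePath`. -/
def knot (h : IsHorizontalWiggle r A) (o : E3) (p q : ℤ) : UnitAddCircle → Torus3 :=
  (h.periodic_torusProj o p q).lift

theorem contDiff_path (h : IsHorizontalWiggle r A) (o : E3) (p q : ℤ) :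
    ContDiff ℝ (⊤ : ℕ∞) (wigglePath o p q r A) :=
  (contDiff_const.add (contDiff_id.smul contDiff_const)).add h.contDiff

theorem isLift (h : IsHorizontalWiggle r A) (o : E3) (p q : ℤ) :
    IsLift (wigglePath o p q r A) (h.knot o p q) :=
  ⟨h.contDiff_path o p q, fun _ => rfl⟩

/-- For r ≠ 0 the vertical speed is r, since the displacement is horizontal; for r = 0 the
displacement is constant and the path is a line. -/
theorem deriv_path_ne_zero (h : IsHorizontalWiggle r A)
    (hprim : Int.gcd (Int.gcd p q : ℤ) r = 1) (o : E3) (t : ℝ) :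
    deriv (wigglePath o p q r A) t ≠ 0 := by
  intro h0
  have hd : HasDerivAt (wigglePath o p q r A) 0 t := by
    rw [← h0]
    exact ((h.contDiff_path o p q).differentiable (by simp) t).hasDerivAt
  by_cases hr : r = 0
  · have hA : wigglePath o p q r A = fun s => o + s • intVec p q r + A 0 := by
      funext s
      rw [wigglePath, h.eq_of_int s 0 0 (by simp [hr])]
    have hd' : HasDerivAt (wigglePath o p q r A) ((1 : ℝ) • intVec p q r) t := by
      rw [hA]
      exact (((hasDerivAt_id t).smul_const (intVec p q r)).const_add o).add_const _
    rw [one_smul] at hd'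
    exact intVec_ne_zero hprim (hd'.unique hd)
  · have h2 : HasDerivAt (fun s => wigglePath o p q r A s 2) 0 t :=
      (EuclideanSpace.proj (𝕜 := ℝ) (2 : Fin 3)).hasFDerivAt.comp_hasDerivAt t hd
    have h3 : (fun s => wigglePath o p q r A s 2) = fun s => o 2 + s * r := by
      funext s
      simp [wigglePath, intVec, h.horizontal s]
    rw [h3] at h2
    have h4 := h2.unique (((hasDerivAt_id t).mul_const (r : ℝ)).const_add (o 2))
    simp [eq_comm, hr] at h4

/-- At a double point the heights agree modulo 1, so the displacements agree and cancel. What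
remains is a double point of the line itself, excluded by primitivity. -/
theorem isTorusKnot (h : IsHorizontalWiggle r A)
    (hprim : Int.gcd (Int.gcd p q : ℤ) r = 1) (o : E3) : IsTorusKnot (h.knot o p q) := by
  refine ⟨?_, _, h.isLift o p q, h.deriv_path_ne_zero hprim o⟩
  intro x y hxy
  obtain ⟨t, rfl⟩ := QuotientAddGroup.mk_surjective x
  obtain ⟨t', rfl⟩ := QuotientAddGroup.mk_surjective y
  have hxy' : torusProj (wigglePath o p q r A t) = torusProj (wigglePath o p q r A t') := hxy
  rw [torusProj_eq_iff] at hxy'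
  obtain ⟨k, hk⟩ := hxy' 2
  have hk' : r * (t - t') = k := by
    rw [← hk]
    simp [wigglePath, intVec, h.horizontal]
    ring
  have hA := h.eq_of_int t t' k hk'
  obtain ⟨i, hi⟩ := hxy' 0
  obtain ⟨j, hj⟩ := hxy' 1
  obtain ⟨m, hm⟩ := exists_int_of_mul_int hprim (x := t - t')
    ⟨i, by rw [← hi]; simp [wigglePath, intVec, hA]; ring⟩
    ⟨j, by rw [← hj]; simp [wigglePath, intVec, hA]; ring⟩ ⟨k, hk'⟩
  change (t : UnitAddCircle) = (t' : UnitAddCircle)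
  rw [← sub_eq_zero, ← AddCircle.coe_sub, AddCircle.coe_eq_zero_iff]
  exact ⟨m, by simp [hm]⟩

theorem isQuasilinear (h : IsHorizontalWiggle r A)
    (hprim : Int.gcd (Int.gcd p q : ℤ) r = 1) (o : E3) : IsQuasilinear (h.knot o p q) := by
  -- The isotopy multiplies the displacement by 1 - s. The linear knot is written with factor `1 -
  -- 1` so that it is definitionally the end of the family.
  refine ⟨(h.smul (1 - 1)).knot o p q, (h.smul _).isTorusKnot hprim o,
    ⟨_, (h.smul _).isLift o p q, o, intVec p q r, intVec_ne_zero hprim, ?_⟩,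
    fun s => (h.smul (1 - s)).knot o p q, fun s => wigglePath o p q r fun t => (1 - s) • A t,
    ?_, ?_, ?_, rfl⟩
  · congr 1
    funext t
    simp [wigglePath]
  · exact (contDiff_const.add (contDiff_snd.smul contDiff_const)).add
      ((contDiff_const.sub contDiff_fst).smul (h.contDiff.comp contDiff_snd))
  · exact fun s _ => ⟨(h.smul _).isTorusKnot hprim o, (h.smul _).isLift o p q⟩
  · funext x
    obtain ⟨t, rfl⟩ := QuotientAddGroup.mk_surjective x
    change torusProj (wigglePath o p q r (fun t => ((1 : ℝ) - 0) • A t) t) =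
      torusProj (wigglePath o p q r A t)
    simp [wigglePath]

end IsHorizontalWiggle

/-! ### Rotation numbers by comparison with a model angle -/

/-- A vector that is never a nonpositive multiple of (cos α, sin α) differs from it by an angle in
(-π, π), which is continuous and periodic and so adds no turns. The case l = 0 of `hslit` makes the
vector nonzero. -/
theorem hasRotationNumber_of_slit {ν V W : ℝ → E3} {ρ c₁ c₂ α : ℝ → ℝ} {k : ℤ}
    (hV : ∀ t, ν t ≠ 0 ∧ V t ≠ 0 ∧ inner ℝ (ν t) (V t) = 0) (hρ : ∀ t, 0 < ρ t)
    (h₁ : Continuous c₁) (h₂ : Continuous c₂) (hα : Continuous α)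
    (hp₁ : Function.Periodic c₁ 1) (hp₂ : Function.Periodic c₂ 1)
    (hα_add : ∀ t, α (t + 1) = α t + 2 * Real.pi * k)
    (hW : ∀ t, W t = ρ t • (c₁ t • V t + c₂ t • cross3 (‖ν t‖⁻¹ • ν t) (V t)))
    (hslit : ∀ t l, 0 ≤ l → c₁ t = -l * Real.cos (α t) → c₂ t ≠ -l * Real.sin (α t)) :
    HasRotationNumber ν V W k := by
  have hexp (t : ℝ) : Complex.exp (α t * Complex.I) =
      Real.cos (α t) + Real.sin (α t) * Complex.I := by
    rw [Complex.exp_mul_I, Complex.ofReal_cos, Complex.ofReal_sin]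
  -- `D` is the vector turned back by α; `hslit` says exactly that it avoids the closed negative
  -- real axis, where `Complex.arg` is discontinuous.
  set D : ℝ → ℂ := fun t => (c₁ t + c₂ t * Complex.I) * Complex.exp (-(α t * Complex.I)) with hD
  have hDexp (t : ℝ) : D t * Complex.exp (α t * Complex.I) = c₁ t + c₂ t * Complex.I := by
    rw [hD]
    simp only
    rw [mul_assoc, ← Complex.exp_add, neg_add_cancel, Complex.exp_zero, mul_one]
  have hDs (t : ℝ) : D t ∈ Complex.slitPlane := by
    rw [Complex.mem_slitPlane_iff_not_le_zero]
    intro hle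
    rw [Complex.le_def] at hle
    have h := hDexp t
    have hDt : D t = (((D t).re : ℝ) : ℂ) := Complex.ext (by simp) (by simpa using hle.2)
    rw [hDt, hexp, mul_add] at h
    have hre := congrArg Complex.re h
    have him := congrArg Complex.im h
    simp [-Complex.ofReal_cos, -Complex.ofReal_sin] at hre him
    exact hslit t (-(D t).re) (by simpa using hle.1) (by linarith) (by linarith)
  have hDc : Continuous D := by fun_prop
  have hDp (t : ℝ) : D (t + 1) = D t := by
    simp only [hD, hp₁ t, hp₂ t, hα_add]
    congr 1
    rw [Complex.exp_eq_exp_iff_exists_int]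
    exact ⟨-k, by push_cast; ring⟩
  refine ⟨hV, fun t => α t + Complex.arg (D t), fun t => ρ t * ‖D t‖, ?_, fun t => ?_, fun t => ?_,
    fun t => ?_⟩
  · rw [continuous_iff_continuousAt]
    intro t
    exact hα.continuousAt.add ((Complex.continuousAt_arg (hDs t)).comp hDc.continuousAt)
  · exact mul_pos (hρ t) (norm_pos_iff.2 (Complex.slitPlane_ne_zero (hDs t)))
  · have h : ‖D t‖ * Complex.exp ((α t + Complex.arg (D t) : ℝ) * Complex.I) =
        c₁ t + c₂ t * Complex.I := by
      rw [← hDexp t]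
      conv_rhs => rw [← Complex.norm_mul_exp_arg_mul_I (D t)]
      push_cast
      rw [add_mul, Complex.exp_add]
      ring
    rw [Complex.exp_mul_I, ← Complex.ofReal_cos, ← Complex.ofReal_sin] at h
    have hre := congrArg Complex.re h
    have him := congrArg Complex.im h
    simp [-Complex.ofReal_cos, -Complex.ofReal_sin] at hre him
    rw [hW t, mul_smul]
    congr 1
    rw [smul_add, smul_smul, smul_smul, hre, him]
  · simp only [hDp, hα_add]
    ring

/-! ### Calculus in the turned frame -/

/-- The vector with coordinates `(x, y, z)` in the standard frame turned by `ψ` about the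
vertical axis. -/
def turned (ψ x y z : ℝ) : E3 :=
  !₂[x * Real.cos ψ - y * Real.sin ψ, x * Real.sin ψ + y * Real.cos ψ, z]

theorem inner_turned (ψ x y z x' y' z' : ℝ) :
    inner ℝ (turned ψ x y z) (turned ψ x' y' z') = x * x' + y * y' + z * z' := by
  simp only [turned, EuclideanSpace.inner_eq_star_dotProduct]
  simp [dotProduct, Fin.sum_univ_three]
  linear_combination (x * x' + y * y') * Real.sin_sq_add_cos_sq ψ

theorem cross3_turned (ψ x y z x' y' z' : ℝ) :
    cross3 (turned ψ x y z) (turned ψ x' y' z') =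
      turned ψ (y * z' - z * y') (z * x' - x * z') (x * y' - y * x') := by
  ext i
  fin_cases i <;> simp [turned, cross3, crossProduct]
  · ring
  · ring
  · linear_combination (x * y' - y * x') * Real.sin_sq_add_cos_sq ψ

theorem smul_turned (c ψ x y z : ℝ) : c • turned ψ x y z = turned ψ (c * x) (c * y) (c * z) := by
  ext i
  fin_cases i <;> simp [turned] <;> ring

theorem turned_add (ψ x y z x' y' z' : ℝ) :
    turned ψ x y z + turned ψ x' y' z' = turned ψ (x + x') (y + y') (z + z') := by
  ext i
  fin_cases i <;> simp [turned] <;> ring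

theorem turned_inj {ψ x y z x' y' z' : ℝ} :
    turned ψ x y z = turned ψ x' y' z' ↔ x = x' ∧ y = y' ∧ z = z' := by
  refine ⟨fun h => ?_, by rintro ⟨rfl, rfl, rfl⟩; rfl⟩
  have h0 := congrArg (· 0) h
  have h1 := congrArg (· 1) h
  have h2 := congrArg (· 2) h
  simp [turned] at h0 h1 h2
  refine ⟨?_, ?_, h2⟩
  · linear_combination Real.cos ψ * h0 + Real.sin ψ * h1 -
      (x - x') * Real.sin_sq_add_cos_sq ψ
  · linear_combination Real.cos ψ * h1 - Real.sin ψ * h0 -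
      (y - y') * Real.sin_sq_add_cos_sq ψ

theorem turned_eq_zero {ψ x y z : ℝ} : turned ψ x y z = 0 ↔ x = 0 ∧ y = 0 ∧ z = 0 := by
  rw [← turned_inj (ψ := ψ)]
  have : turned ψ 0 0 0 = 0 := by
    ext i
    fin_cases i <;> simp [turned]
  rw [this]

theorem turned_apply_two (ψ x y z : ℝ) : turned ψ x y z 2 = z := rfl

theorem continuous_turned {X : Type*} [TopologicalSpace X] (ψ : ℝ) {a b c : X → ℝ}
    (ha : Continuous a) (hb : Continuous b) (hc : Continuous c) :
    Continuous fun x => turned ψ (a x) (b x) (c x) := by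
  refine continuous_vec3 ?_ ?_ ?_ <;> fun_prop

theorem hasDerivAt_turned (ψ : ℝ) {a b c : ℝ → ℝ} {a' b' c' t : ℝ} (ha : HasDerivAt a a' t)
    (hb : HasDerivAt b b' t) (hc : HasDerivAt c c' t) :
    HasDerivAt (fun s => turned ψ (a s) (b s) (c s)) (turned ψ a' b' c') t :=
  hasDerivAt_vec3 ((ha.mul_const _).sub (hb.mul_const _)) ((ha.mul_const _).add (hb.mul_const _)) hc

theorem turned_mem_contactPlane {n : ℕ} {x₀ : E3} {ψ φ x y z : ℝ}
    (hφ : 2 * Real.pi * n * x₀ 2 = ψ + φ) :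
    turned ψ x y z ∈ contactPlane n x₀ ↔ x * Real.cos φ + y * Real.sin φ = 0 := by
  have h : contactForm n x₀ (turned ψ x y z) = x * Real.cos φ + y * Real.sin φ := by
    simp [contactForm, turned, hφ, Real.cos_add, Real.sin_add]
    linear_combination (x * Real.cos φ + y * Real.sin φ) * Real.sin_sq_add_cos_sq ψ
  rw [contactPlane, LinearMap.mem_ker, h]

theorem contactNormal_eq_turned {n : ℕ} {x₀ : E3} {ψ φ : ℝ}
    (hφ : 2 * Real.pi * n * x₀ 2 = ψ + φ) :
    contactNormal n x₀ = turned ψ (Real.cos φ) (Real.sin φ) 0 := by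
  ext i
  fin_cases i <;> simp [contactNormal, turned, hφ, Real.cos_add, Real.sin_add] <;> ring

theorem exists_equiv_of_frame {v f g : E3}
    (h : ∀ s w y : ℝ, s • v + w • f + y • g = 0 → s = 0 ∧ w = 0 ∧ y = 0) :
    ∃ M : E3 ≃L[ℝ] E3, ∀ s w y : ℝ, M !₂[s, w, y] = s • v + w • f + y • g := by
  let L : E3 →ₗ[ℝ] E3 := (EuclideanSpace.projₗ (𝕜 := ℝ) (0 : Fin 3)).smulRight v +
    (EuclideanSpace.projₗ (𝕜 := ℝ) (1 : Fin 3)).smulRight f +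
    (EuclideanSpace.projₗ (𝕜 := ℝ) (2 : Fin 3)).smulRight g
  have hL (x : E3) : L x = x 0 • v + x 1 • f + x 2 • g := by simp [L]
  have hinj : Function.Injective L := by
    rw [injective_iff_map_eq_zero]
    intro x hx
    rw [hL] at hx
    obtain ⟨h0, h1, h2⟩ := h _ _ _ hx
    ext i
    fin_cases i <;> assumption
  exact ⟨(LinearEquiv.ofInjectiveEndo L hinj).toContinuousLinearEquiv, fun s w y => hL !₂[s, w, y]⟩

section affineShear

variable {o : E3} {M : E3 ≃L[ℝ] E3} {a b χ : ℝ → ℝ}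

theorem axisImage_affineShear {ha : Continuous a} {hb : Continuous b} {hχ : Continuous χ}
    (hχ1 : ∀ t, χ (a t) = 1) (t : ℝ) :
    axisImage (affineShear o M a b χ ha hb hχ) t = o + M !₂[t, a t, b t] := by
  simp [axisImage, affineShear_apply, hχ1]

theorem smul_deriv_add_mem_posTangentConeAt (ha : ContDiff ℝ (⊤ : ℕ∞) a)
    (hb : ContDiff ℝ (⊤ : ℕ∞) b)
    (hχ : ContDiff ℝ (⊤ : ℕ∞) χ) (hpa : Function.Periodic a 1) (hpb : Function.Periodic b 1)
    {K : ℝ} (haK : ∀ t, |a t| < K) (hχ1 : ∀ w, w ≤ K → χ w = 1) (t l : ℝ) {m : ℝ} (hm : 0 ≤ m) :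
    l • deriv (axisImage (affineShear o M a b χ ha.continuous hb.continuous hχ.continuous)) t +
      m • M !₂[0, 1, 0] ∈ posTangentConeAt
        (halfPlaneImage (affineShear o M a b χ ha.continuous hb.continuous hχ.continuous))
        (axisImage (affineShear o M a b χ ha.continuous hb.continuous hχ.continuous) t) := by
  have h := isPeriodicDiffeo_affineShear o M ha hb hχ hpa hpb
  set Ψ := affineShear o M a b χ ha.continuous hb.continuous hχ.continuous with hΨ
  have hd := (h.contDiff.differentiable (by simp) !₂[t, 0, 0]).hasFDerivAt
  have h0 : HasDerivAt (axisImage Ψ) (fderiv ℝ Ψ !₂[t, 0, 0] !₂[1, 0, 0]) t :=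
    hd.comp_hasDerivAt t (hasDerivAt_vec3 (hasDerivAt_id t) (hasDerivAt_const t 0)
      (hasDerivAt_const t 0))
  have h1 : HasDerivAt (fun s : ℝ => Ψ !₂[t, s, 0]) (fderiv ℝ Ψ !₂[t, 0, 0] !₂[0, 1, 0]) 0 :=
    HasFDerivAt.comp_hasDerivAt (0 : ℝ) (f := fun s : ℝ => (!₂[t, s, 0] : E3)) hd
      (hasDerivAt_vec3 (hasDerivAt_const 0 t) (hasDerivAt_id 0) (hasDerivAt_const 0 0))
  have h2 : HasDerivAt (fun s : ℝ => Ψ !₂[t, s, 0]) (M !₂[0, 1, 0]) 0 := by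
    have h3 : HasDerivAt (fun s : ℝ => o + M !₂[t, s + a t, b t]) (M !₂[0, 1, 0]) 0 :=
      (M.hasFDerivAt.comp_hasDerivAt (0 : ℝ) (hasDerivAt_vec3 (hasDerivAt_const 0 t)
        ((hasDerivAt_id (0 : ℝ)).add_const (a t)) (hasDerivAt_const 0 (b t)))).const_add o
    refine h3.congr_of_eventuallyEq ?_
    have h4 : ∀ᶠ s : ℝ in nhds 0, s < K - a t :=
      eventually_lt_nhds (by linarith [(abs_lt.1 (haK t)).2])
    filter_upwards [h4] with s hs
    have : χ (s + a t) = 1 := hχ1 _ (by linarith)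
    simp [hΨ, affineShear_apply, this]
  rw [h0.deriv, ← h1.unique h2, ← map_smul, ← map_smul, ← map_add]
  convert h.mem_posTangentConeAt t (l := l) hm using 2
  ext i
  fin_cases i <;> simp

end affineShear

/-- The rotation number of the contact framing relative to the framing by the direction
`turned ψ 1 0 0`, along a curve with velocity `turned ψ (x t) (y t) r`. -/
theorem hasRotationNumber_contact_framing {ψ r : ℝ} (hr : r ≠ 0) {x y β : ℝ → ℝ} {k : ℤ}
    (hx : Continuous x) (hy : Continuous y) (hβ : Continuous β) (hpx : Function.Periodic x 1)
    (hpy : Function.Periodic y 1) (hβ_add : ∀ t, SignType.sign r * β (t + 1) =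
      SignType.sign r * β t + 2 * Real.pi * k) {l m : ℝ → ℝ} (hl : ∀ t, 0 < l t)
    (hm : ∀ t, 0 < m t) (hcos : Function.Periodic (fun t => Real.cos (β t)) 1)
    (hsin : Function.Periodic (fun t => Real.sin (β t)) 1) :
    HasRotationNumber (fun t => turned ψ (x t) (y t) r)
      (fun t => l t • turned ψ (y t ^ 2 + r ^ 2) (-(x t * y t)) (-(x t * r)))
      (fun t => m t • turned ψ
        ((y t ^ 2 + r ^ 2) * Real.cos (β t) - x t * y t * Real.sin (β t))
        ((x t ^ 2 + r ^ 2) * Real.sin (β t) - x t * y t * Real.cos (β t))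
        (-(x t * Real.cos (β t) + y t * Real.sin (β t)) * r)) k := by
  have hQ (t : ℝ) : 0 < y t ^ 2 + r ^ 2 := by positivity
  have hν (t : ℝ) : turned ψ (x t) (y t) r ≠ 0 := fun h => hr (turned_eq_zero.1 h).2.2
  -- The model angle carries the sign of r because projecting the horizontal plane to the normal
  -- plane reverses orientation when r < 0.
  refine hasRotationNumber_of_slit (α := fun t => SignType.sign r * β t)
    (ρ := fun t => m t * (l t)⁻¹ * (y t ^ 2 + r ^ 2)⁻¹)
    (c₁ := fun t => (y t ^ 2 + r ^ 2) * Real.cos (β t) - x t * y t * Real.sin (β t))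
    (c₂ := fun t => r * ‖turned ψ (x t) (y t) r‖ * Real.sin (β t)) ?_ ?_ ?_ ?_ ?_ ?_ ?_ hβ_add ?_ ?_
  · refine fun t => ⟨hν t, smul_ne_zero (hl t).ne' fun h => (hQ t).ne' (turned_eq_zero.1 h).1, ?_⟩
    rw [inner_smul_right, inner_turned]
    ring
  · exact fun t => mul_pos (mul_pos (hm t) (inv_pos.2 (hl t))) (inv_pos.2 (hQ t))
  · fun_prop
  · exact (continuous_const.mul (continuous_turned ψ hx hy continuous_const).norm).mul
      (Real.continuous_sin.comp hβ)
  · fun_prop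
  · intro t
    simp only [hpx t, hpy t, hcos t, hsin t]
  · intro t
    simp only [hpx t, hpy t, hsin t]
  · intro t
    have hN : ‖turned ψ (x t) (y t) r‖ ≠ 0 := norm_ne_zero_iff.2 (hν t)
    have hl' := (hl t).ne'
    have hQ' := (hQ t).ne'
    simp only [smul_turned, cross3_turned, turned_add, turned_inj]
    refine ⟨?_, ?_, ?_⟩ <;> field_simp <;> ring
  -- If the vector were opposite to the model, the second equation would make |r|‖ν‖ + s times sin β
  -- zero. Then sin β = 0, and the first equation forces cos β = 0 as well.
  · intro t s hs h₁ h₂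
    have hN : 0 < ‖turned ψ (x t) (y t) r‖ := norm_pos_iff.2 (hν t)
    have hsign : (SignType.sign r : ℝ) = 1 ∨ (SignType.sign r : ℝ) = -1 := by
      rcases hr.lt_or_gt with h | h <;> simp [h]
    have hsin0 : Real.sin (β t) = 0 := by
      have h3 : (|r| * ‖turned ψ (x t) (y t) r‖ + s) * Real.sin (β t) = 0 := by
        rcases hr.lt_or_gt with h | h
        · simp only [sign_neg h, SignType.coe_neg_one, neg_mul, one_mul, Real.sin_neg] at h₂
          rw [abs_of_neg h]
          linear_combination -h₂
        · simp only [sign_pos h, SignType.coe_one, neg_mul, one_mul] at h₂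
          rw [abs_of_pos h]
          linear_combination h₂
      have : 0 < |r| * ‖turned ψ (x t) (y t) r‖ + s := by positivity
      exact (mul_eq_zero.1 h3).resolve_left this.ne'
    have hcos0 : Real.cos (β t) = 0 := by
      have h3 : ((y t ^ 2 + r ^ 2) + s) * Real.cos (β t) = 0 := by
        rcases hsign with h | h <;> simp only [h, neg_mul, one_mul, Real.cos_neg, hsin0] at h₁ <;>
          linear_combination h₁
      exact (mul_eq_zero.1 h3).resolve_left (by have := hQ t; positivity)
    have := Real.sin_sq_add_cos_sq (β t)
    simp [hsin0, hcos0] at this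

/-! ### Construction of the Legendrian knots -/

/-- Common assembly for both cases: the topology of knot and surface is settled here. Only tangency
and the two rotation counts are left, and these need from the surface just its inward tangent
vectors along the knot and the flat half-plane starting at w = K + 1. -/
theorem exists_legendrian_of_frame (n : ℕ) {p q r : ℤ}
    (hprim : Int.gcd (Int.gcd p q : ℤ) r = 1) (o : E3) (M : E3 ≃L[ℝ] E3) {a b : ℝ → ℝ}
    (ha : ContDiff ℝ (⊤ : ℕ∞) a) (hb : ContDiff ℝ (⊤ : ℕ∞) b) (hpa : Function.Periodic a 1)
    (hpb : Function.Periodic b 1) {K : ℝ} (haK : ∀ t, |a t| < K) (hbK : ∀ t, |b t| < K)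
    (hM : M !₂[1, 0, 0] = intVec p q r) {A : ℝ → E3} (hA : ∀ t, M !₂[0, a t, b t] = A t)
    (hw : IsHorizontalWiggle r A) {tb : ℤ} (htb : tb = |r| * n)
    (hleg : ∀ t, deriv (wigglePath o p q r A) t ∈ contactPlane n (wigglePath o p q r A t))
    (hTB : ∀ S, (∀ t l m : ℝ, 0 ≤ m → l • deriv (wigglePath o p q r A) t + m • M !₂[0, 1, 0] ∈
      posTangentConeAt S (wigglePath o p q r A t)) →
      HasThurstonBennequin n (wigglePath o p q r A) S tb)
    (hMas : ∀ S, affineHalfPlane (o + M !₂[0, K + 1, 0]) (M !₂[1, 0, 0]) (M !₂[0, 1, 0]) ⊆ S →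
      HasMaslovNumber n (wigglePath o p q r A) (intVec p q r) S 0) :
    ∃ (α : UnitAddCircle → Torus3) (γ : ℝ → E3),
      IsTorusKnot α ∧ IsLegendrian n α ∧ IsQuasilinear α ∧
      IsLift γ α ∧ (∀ t, γ (t + 1) = γ t + intVec p q r) ∧
      ∃ (S : Set E3) (tb rot χ : ℤ),
        IsCoveringSeifertSurface γ (intVec p q r) S ∧
        HasThurstonBennequin n γ S tb ∧
        HasMaslovNumber n γ (intVec p q r) S rot ∧
        HasEulerCharacteristic (seifertQuotient (intVec p q r) S) χ ∧
        tb + rot = -χ + |r| * n ∧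
        rot = 0 ∧ tb = |r| * n ∧ χ = 0 := by
  have hχ : ContDiff ℝ (⊤ : ℕ∞) fun w => Real.smoothTransition (K + 1 - w) :=
    Real.smoothTransition.contDiff.comp (contDiff_const.sub contDiff_id)
  have hχ1 (w : ℝ) (hw : w ≤ K) : Real.smoothTransition (K + 1 - w) = 1 :=
    Real.smoothTransition.one_of_one_le (by linarith)
  have hχ0 (w : ℝ) (hw : K + 1 ≤ w) : Real.smoothTransition (K + 1 - w) = 0 :=
    Real.smoothTransition.zero_of_nonpos (by linarith)
  have hΨ := isPeriodicDiffeo_affineShear o M ha hb hχ hpa hpb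
  have htan := @smul_deriv_add_mem_posTangentConeAt o M a b _ ha hb hχ hpa hpb K haK hχ1
  have hS := isCoveringSeifertSurface_affineShear o M ha hb hχ hpa hpb (fun t => (haK t).le)
    (fun t => (hbK t).le) (fun w => abs_le.2
      ⟨by linarith [Real.smoothTransition.nonneg (K + 1 - w)], Real.smoothTransition.le_one _⟩) hχ0
  have hγ : axisImage (affineShear o M a b _ ha.continuous hb.continuous hχ.continuous) =
      wigglePath o p q r A := by
    funext t
    rw [axisImage_affineShear (χ := fun w => Real.smoothTransition (K + 1 - w))
      fun t => hχ1 _ (abs_le.1 (haK t).le).2, wigglePath, ← hA, ← hM,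
      add_assoc, ← map_smul, ← map_add]
    congr 2
    ext i
    fin_cases i <;> simp
  rw [hγ] at htan hS
  rw [hM] at hΨ hS
  refine ⟨hw.knot o p q, wigglePath o p q r A, hw.isTorusKnot hprim o,
    ⟨_, hw.isLift o p q, hleg⟩, hw.isQuasilinear hprim o, hw.isLift o p q, hw.path_add_one o p q,
    _, tb, 0, 0, hS, hTB _ fun t l m hm => htan t l hm, hMas _ ?_, hΨ.hasEulerCharacteristic,
    by simp [htb], rfl, htb, rfl⟩
  rintro _ ⟨s, u, hu, rfl⟩
  rw [mem_halfPlaneImage_affineShear]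
  refine ⟨s, K + 1 + u, by linarith [(abs_le.1 (haK s).le).2], ?_⟩
  rw [hχ0 _ (by linarith), mul_zero, add_assoc, add_assoc, ← map_smul, ← map_smul, ← map_add,
    ← map_add]
  congr 2
  ext i
  fin_cases i <;> simp

theorem exists_polar_int (p q : ℤ) :
    ∃ c ψ : ℝ, (p : ℝ) = c * Real.cos ψ ∧ (q : ℝ) = c * Real.sin ψ :=
  ⟨‖(⟨p, q⟩ : ℂ)‖, Complex.arg ⟨p, q⟩, (Complex.norm_mul_cos_arg ⟨p, q⟩).symm,
    (Complex.norm_mul_sin_arg ⟨p, q⟩).symm⟩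

theorem norm_inv_norm_smul {x : E3} (hx : x ≠ 0) : ‖‖x‖⁻¹ • x‖ = 1 := by
  rw [norm_smul, norm_inv, norm_norm, inv_mul_cancel₀ (norm_ne_zero_iff.2 hx)]

theorem exists_legendrian_of_height_ne_zero (n : ℕ) (hn : 0 < n) {p q r : ℤ} (hr : r ≠ 0)
    (hprim : Int.gcd (Int.gcd p q : ℤ) r = 1) :
    ∃ (α : UnitAddCircle → Torus3) (γ : ℝ → E3),
      IsTorusKnot α ∧ IsLegendrian n α ∧ IsQuasilinear α ∧
      IsLift γ α ∧ (∀ t, γ (t + 1) = γ t + intVec p q r) ∧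
      ∃ (S : Set E3) (tb rot χ : ℤ),
        IsCoveringSeifertSurface γ (intVec p q r) S ∧
        HasThurstonBennequin n γ S tb ∧
        HasMaslovNumber n γ (intVec p q r) S rot ∧
        HasEulerCharacteristic (seifertQuotient (intVec p q r) S) χ ∧
        tb + rot = -χ + |r| * n ∧
        rot = 0 ∧ tb = |r| * n ∧ χ = 0 := by
  obtain ⟨c, ψ, hp, hq⟩ := exists_polar_int p q
  have hn' : (n : ℝ) ≠ 0 := by exact_mod_cast hn.ne'
  have hr' : (r : ℝ) ≠ 0 := by exact_mod_cast hr
  have hπ := Real.pi_pos.ne'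
  have hv : intVec p q r = turned ψ c 0 r := by
    ext i
    fin_cases i <;> simp [intVec, turned, hp, hq]
  obtain ⟨M, hM⟩ := exists_equiv_of_frame (v := turned ψ c 0 r) (f := turned ψ 1 0 0)
    (g := turned ψ 0 1 0) (by
      intro s w y h
      simp only [smul_turned, turned_add, turned_eq_zero] at h
      obtain ⟨h0, h1, h2⟩ := h
      have hs : s = 0 := by simpa [hr'] using h2
      subst hs
      simp at h0 h1
      exact ⟨rfl, h0, h1⟩)
  have hM' (s w y : ℝ) : M !₂[s, w, y] = turned ψ (s * c + w) y (s * r) := by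
    rw [hM, smul_turned, smul_turned, smul_turned, turned_add, turned_add]
    congr 1 <;> ring
  set ω : ℝ := 2 * Real.pi * n * r with hω
  have hω0 : ω ≠ 0 := by positivity
  -- `a` and `b` integrate the oscillating part of the horizontal velocity (2c sin² ωt, -2c sin ωt
  -- cos ωt), whose mean is (c, 0).
  set a : ℝ → ℝ := fun t => -(c / (2 * ω)) * Real.sin (2 * ω * t) with ha
  set b : ℝ → ℝ := fun t => c / (2 * ω) * Real.cos (2 * ω * t) with hb
  set x : ℝ → ℝ := fun t => c - c * Real.cos (2 * ω * t) with hx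
  set y : ℝ → ℝ := fun t => -(c * Real.sin (2 * ω * t)) with hy
  -- This starting height makes the contact normal point along ψ at t = 0.
  set o : E3 := turned ψ 0 0 (ψ / (2 * Real.pi * n)) with ho
  set A : ℝ → E3 := fun t => turned ψ (a t) (b t) 0 with hA
  have hab (t t' : ℝ) (m : ℤ) (h : r * (t - t') = m) : a t = a t' ∧ b t = b t' := by
    have h' : 2 * ω * t = 2 * ω * t' + (2 * n * m : ℤ) * (2 * Real.pi) := by
      push_cast
      rw [← h, hω]
      ring
    simp only [ha, hb, h', Real.sin_add_int_mul_two_pi, Real.cos_add_int_mul_two_pi, and_self]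
  have hω1 (t : ℝ) : ω * (t + 1) = ω * t + (n * r : ℤ) * (2 * Real.pi) := by
    push_cast
    rw [hω]
    ring
  have h2ω1 (t : ℝ) : 2 * ω * (t + 1) = 2 * ω * t + (2 * n * r : ℤ) * (2 * Real.pi) := by
    push_cast
    rw [hω]
    ring
  have hwig : IsHorizontalWiggle r A := by
    refine ⟨?_, fun t => rfl, fun t t' m h => ?_⟩
    · refine contDiff_vec3 ?_ ?_ ?_ <;> fun_prop
    · simp only [hA, hab t t' m h]
  have hγ (t : ℝ) : wigglePath o p q r A t =
      turned ψ (t * c + a t) (b t) (ψ / (2 * Real.pi * n) + t * r) := by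
    simp only [wigglePath, ho, hv, hA, smul_turned, turned_add]
    congr 1 <;> ring
  have hd (t : ℝ) : HasDerivAt (wigglePath o p q r A) (turned ψ (x t) (y t) r) t := by
    rw [funext hγ]
    have h2 : HasDerivAt (fun t => 2 * ω * t) (2 * ω) t := by
      simpa using (hasDerivAt_id t).const_mul (2 * ω)
    refine hasDerivAt_turned ψ ?_ ?_ ?_
    · convert! ((hasDerivAt_id t).mul_const c).add (h2.sin.const_mul (-(c / (2 * ω)))) using 1
      simp only [hx]
      field_simp
      ring
    · convert! h2.cos.const_mul (c / (2 * ω)) using 1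
      simp only [hy]
      field_simp
    · simpa using ((hasDerivAt_id t).mul_const (r : ℝ)).const_add (ψ / (2 * Real.pi * n))
  have hderiv : deriv (wigglePath o p q r A) = fun t => turned ψ (x t) (y t) r :=
    funext fun t => (hd t).deriv
  have hφ (t : ℝ) : 2 * Real.pi * n * wigglePath o p q r A t 2 = ψ + ω * t := by
    rw [hγ, turned_apply_two, hω]
    field_simp
  have hxs (t : ℝ) : x t = 2 * c * Real.sin (ω * t) ^ 2 := by
    simp only [hx]
    rw [mul_assoc, Real.cos_two_mul]
    linear_combination -2 * c * Real.sin_sq_add_cos_sq (ω * t)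
  have hys (t : ℝ) : y t = -(2 * c * Real.sin (ω * t) * Real.cos (ω * t)) := by
    simp only [hy]
    rw [mul_assoc, Real.sin_two_mul]
    ring
  have hleg (t : ℝ) : x t * Real.cos (ω * t) + y t * Real.sin (ω * t) = 0 := by
    rw [hxs, hys]
    ring
  have hxc : Continuous x := by fun_prop
  have hyc : Continuous y := by fun_prop
  have hpx : Function.Periodic x 1 := fun t => by
    simp only [hx, h2ω1, Real.cos_add_int_mul_two_pi]
  have hpy : Function.Periodic y 1 := fun t => by
    simp only [hy, h2ω1, Real.sin_add_int_mul_two_pi]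
  have hbound (u : ℝ) (hu : |u| ≤ 1) : |c / (2 * ω) * u| < |c / (2 * ω)| + 1 := by
    rw [abs_mul]
    nlinarith [abs_nonneg (c / (2 * ω))]
  refine exists_legendrian_of_frame n hprim o M (a := a) (b := b) (A := A)
    (K := |c / (2 * ω)| + 1) (tb := |r| * n) (by fun_prop) (by fun_prop)
    (fun t => (hab _ _ r (by ring)).1) (fun t => (hab _ _ r (by ring)).2)
    (fun t => ?_) (fun t => hbound _ (Real.abs_cos_le_one _)) ?_ (fun t => ?_) hwig rfl
    (fun t => ?_) (fun S hS => ?_) (fun S hS => ?_)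
  · simp only [ha, neg_mul, abs_neg]
    exact hbound _ (Real.abs_sin_le_one _)
  · rw [hM', hv]
    simp
  · rw [hM']
    simp [hA]
  · rw [hderiv, turned_mem_contactPlane (hφ t)]
    exact hleg t
  -- The horizontal contact direction has angle β in the turned axes. `X` and `Y` are |γ'|² times
  -- the projections orthogonal to γ' of the first axis and of this direction.
  · set β : ℝ → ℝ := fun t => ω * t + Real.pi / 2 with hβ
    have hcβ (t : ℝ) : Real.cos (β t) = -Real.sin (ω * t) := Real.cos_add_pi_div_two _
    have hsβ (t : ℝ) : Real.sin (β t) = Real.cos (ω * t) := Real.sin_add_pi_div_two _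
    set X : ℝ → E3 := fun t => turned ψ (y t ^ 2 + r ^ 2) (-(x t * y t)) (-(x t * r)) with hXdef
    set Y : ℝ → E3 := fun t => turned ψ
        ((y t ^ 2 + r ^ 2) * Real.cos (β t) - x t * y t * Real.sin (β t))
        ((x t ^ 2 + r ^ 2) * Real.sin (β t) - x t * y t * Real.cos (β t))
        (-(x t * Real.cos (β t) + y t * Real.sin (β t)) * r) with hYdef
    have hX (t : ℝ) : X t ≠ 0 := fun h => by
      have h0 : y t ^ 2 + (r : ℝ) ^ 2 ≠ 0 := by positivity
      exact h0 (turned_eq_zero.1 h).1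
    have hY (t : ℝ) : Y t ≠ 0 := fun h => by
      obtain ⟨h0, h1, h2⟩ := turned_eq_zero.1 h
      have h3 : x t * Real.cos (β t) + y t * Real.sin (β t) = 0 :=
        neg_eq_zero.1 ((mul_eq_zero.1 h2).resolve_right hr')
      have hQ : x t ^ 2 + y t ^ 2 + (r : ℝ) ^ 2 ≠ 0 := by positivity
      have h4 : (x t ^ 2 + y t ^ 2 + (r : ℝ) ^ 2) * Real.cos (β t) = 0 := by
        linear_combination h0 + x t * h3
      have h5 : (x t ^ 2 + y t ^ 2 + (r : ℝ) ^ 2) * Real.sin (β t) = 0 := by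
        linear_combination h1 + y t * h3
      have := Real.sin_sq_add_cos_sq (β t)
      rw [(mul_eq_zero.1 h4).resolve_left hQ, (mul_eq_zero.1 h5).resolve_left hQ] at this
      norm_num at this
    have hXc : Continuous X :=
      continuous_turned ψ (by fun_prop) (by fun_prop) (by fun_prop)
    have hYc : Continuous Y :=
      continuous_turned ψ (by fun_prop) (by fun_prop) (by fun_prop)
    refine ⟨fun t => ‖X t‖⁻¹ • X t, fun t => ‖Y t‖⁻¹ • Y t,
      (hXc.norm.inv₀ fun t => norm_ne_zero_iff.2 (hX t)).smul hXc,
      (hYc.norm.inv₀ fun t => norm_ne_zero_iff.2 (hY t)).smul hYc,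
      fun t => ⟨norm_inv_norm_smul (hX t), ?_, ?_⟩,
      fun t => ⟨norm_inv_norm_smul (hY t), ?_, Submodule.smul_mem _ _ ?_⟩, ?_⟩
    · rw [inner_smul_right, hderiv, inner_turned]
      ring
    · have hm : 0 ≤ ‖X t‖⁻¹ * (x t ^ 2 + y t ^ 2 + r ^ 2) := by positivity
      -- Before normalization, `X` is |γ'|² times the first axis minus x times γ', and the
      -- coefficient of the inward vector is positive.
      convert hS t (‖X t‖⁻¹ * -x t) _ hm using 1
      change ‖X t‖⁻¹ • turned ψ _ _ _ = _
      rw [hderiv, hM', smul_turned, smul_turned, smul_turned, turned_add]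
      congr 1 <;> ring
    · rw [inner_smul_right, hderiv, inner_turned]
      ring
    · rw [turned_mem_contactPlane (hφ t), hcβ, hsβ]
      linear_combination (x t * Real.sin (ω * t) - y t * Real.cos (ω * t)) * hleg t
    · rw [hderiv]
      refine hasRotationNumber_contact_framing hr' hxc hyc (by fun_prop) hpx hpy (fun t => ?_)
        (fun t => inv_pos.2 (norm_pos_iff.2 (hX t))) (fun t => inv_pos.2 (norm_pos_iff.2 (hY t)))
        (fun t => ?_) (fun t => ?_)
      · simp only [hβ, hω]
        have : (SignType.sign (r : ℝ) : ℝ) * r = |(r : ℝ)| := sign_mul_self _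
        push_cast
        linear_combination 2 * Real.pi * n * this
      · simp only [hcβ, hω1, Real.sin_add_int_mul_two_pi]
      · simp only [hsβ, hω1, Real.cos_add_int_mul_two_pi]
  -- Scaling the vertical section by r makes the component of γ' along Z equal to 1, whatever the
  -- sign of r.
  · refine ⟨fun _ => turned ψ 0 0 r, _, _, _, linearIndependent_map_pair M, hS, continuousOn_const,
      fun z _ => ⟨fun h => hr' (turned_eq_zero.1 h).2.2, ?_, rfl⟩, fun z _ => ?_, ?_⟩
    · rw [turned_mem_contactPlane (ψ := ψ) (φ := 2 * Real.pi * n * z 2 - ψ) (by ring)]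
      simp
    · rw [Submodule.mem_span_pair]
      -- The vertical vector is the period minus c times the first axis, so it is tangent to the
      -- half-plane.
      refine ⟨1, -c, ?_⟩
      rw [hM', hM', smul_turned, smul_turned, turned_add]
      congr 1 <;> ring
    · have hN (t : ℝ) : ‖turned ψ (Real.cos (ω * t)) (Real.sin (ω * t)) 0‖ = 1 := by
        rw [norm_eq_sqrt_real_inner, inner_turned, Real.sqrt_eq_one]
        linear_combination Real.sin_sq_add_cos_sq (ω * t)
      simp only [contactNormal_eq_turned (hφ _), hderiv]
      refine hasRotationNumber_of_slit (α := fun _ => 0) (ρ := fun _ => 1) (c₁ := fun _ => 1)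
        (c₂ := fun t => 2 * c * Real.sin (ω * t) / r) (fun t => ⟨?_, ?_, ?_⟩)
        (fun _ => one_pos) continuous_const (by fun_prop) continuous_const (fun _ => rfl)
        (fun t => ?_) (fun t => by simp) (fun t => ?_) (fun t l hl h => ?_)
      · rw [← norm_ne_zero_iff, hN]
        exact one_ne_zero
      · exact fun h => hr' (turned_eq_zero.1 h).2.2
      · rw [inner_turned]
        ring
      · simp only [hω1, Real.sin_add_int_mul_two_pi]
      · simp only [hN, inv_one, one_smul, cross3_turned, smul_turned, turned_add, turned_inj, hxs,
          hys]
        refine ⟨?_, ?_, ?_⟩ <;> field_simp <;> ring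
      · rw [Real.cos_zero] at h
        linarith

theorem exists_legendrian_of_height_eq_zero (n : ℕ) (hn : 0 < n) {p q r : ℤ} (hr : r = 0)
    (hprim : Int.gcd (Int.gcd p q : ℤ) r = 1) :
    ∃ (α : UnitAddCircle → Torus3) (γ : ℝ → E3),
      IsTorusKnot α ∧ IsLegendrian n α ∧ IsQuasilinear α ∧
      IsLift γ α ∧ (∀ t, γ (t + 1) = γ t + intVec p q r) ∧
      ∃ (S : Set E3) (tb rot χ : ℤ),
        IsCoveringSeifertSurface γ (intVec p q r) S ∧
        HasThurstonBennequin n γ S tb ∧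
        HasMaslovNumber n γ (intVec p q r) S rot ∧
        HasEulerCharacteristic (seifertQuotient (intVec p q r) S) χ ∧
        tb + rot = -χ + |r| * n ∧
        rot = 0 ∧ tb = |r| * n ∧ χ = 0 := by
  obtain ⟨c, ψ, hp, hq⟩ := exists_polar_int p q
  have hn' : (n : ℝ) ≠ 0 := by exact_mod_cast hn.ne'
  have hπ := Real.pi_pos.ne'
  have hv : intVec p q r = turned ψ c 0 0 := by
    ext i
    fin_cases i <;> simp [intVec, turned, hp, hq, hr]
  have hc0 : c ≠ 0 := by
    rintro rfl
    exact intVec_ne_zero hprim (hv.trans (turned_eq_zero.2 ⟨rfl, rfl, rfl⟩))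
  obtain ⟨M, hM⟩ := exists_equiv_of_frame (v := turned ψ c 0 0) (f := turned ψ 0 0 1)
    (g := turned ψ 0 1 0) (by
      intro s w y h
      simp only [smul_turned, turned_add, turned_eq_zero] at h
      obtain ⟨h0, h1, h2⟩ := h
      exact ⟨by simpa [hc0] using h0, by simpa using h2, by simpa using h1⟩)
  have hM' (s w y : ℝ) : M !₂[s, w, y] = turned ψ (s * c) y w := by
    rw [hM, smul_turned, smul_turned, smul_turned, turned_add, turned_add]
    congr 1 <;> ring
  -- At this height the contact normal is perpendicular to (p, q, 0), so the line is Legendrian.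
  set o : E3 := turned ψ 0 0 ((ψ + Real.pi / 2) / (2 * Real.pi * n)) with ho
  have hwig : IsHorizontalWiggle r fun _ => (0 : E3) :=
    ⟨contDiff_const, fun _ => rfl, fun _ _ _ _ => rfl⟩
  have hγ (t : ℝ) : wigglePath o p q r (fun _ => 0) t =
      turned ψ (t * c) 0 ((ψ + Real.pi / 2) / (2 * Real.pi * n)) := by
    simp only [wigglePath, ho, hv, add_zero, smul_turned, turned_add]
    congr 1 <;> ring
  have hderiv : deriv (wigglePath o p q r fun _ => 0) = fun t => turned ψ c 0 0 := by
    funext t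
    rw [funext hγ]
    refine (hasDerivAt_turned ψ ?_ (hasDerivAt_const _ _) (hasDerivAt_const _ _)).deriv
    simpa using (hasDerivAt_id t).mul_const c
  have hφ (t : ℝ) : 2 * Real.pi * n * wigglePath o p q r (fun _ => 0) t 2 = ψ + Real.pi / 2 := by
    rw [hγ, turned_apply_two]
    field_simp
  have hk : turned ψ 0 0 1 ≠ 0 := fun h => one_ne_zero (turned_eq_zero.1 h).2.2
  have hunit : ‖turned ψ 0 0 1‖ = 1 := by
    rw [norm_eq_sqrt_real_inner, inner_turned, Real.sqrt_eq_one]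
    ring
  refine exists_legendrian_of_frame n hprim o M (a := fun _ => 0) (b := fun _ => 0)
    (A := fun _ => 0) (K := 1) (tb := 0) contDiff_const contDiff_const (fun _ => rfl) (fun _ => rfl)
    (fun t => by simp) (fun t => by simp) ?_ (fun t => ?_) hwig (by simp [hr])
    (fun t => ?_) (fun S hS => ?_) (fun S hS => ?_)
  · rw [hM', hv, one_mul]
  · rw [hM', turned_eq_zero]
    simp
  · rw [hderiv, turned_mem_contactPlane (hφ t)]
    simp
  · refine ⟨fun _ => turned ψ 0 0 1, fun _ => turned ψ 0 0 1, continuous_const, continuous_const,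
      fun t => ⟨hunit, ?_, ?_⟩, fun t => ⟨hunit, ?_, ?_⟩, ?_⟩
    · rw [hderiv, inner_turned]
      ring
    · convert hS t 0 1 zero_le_one using 1
      rw [hM', zero_smul, zero_add, one_smul, zero_mul]
    · rw [hderiv, inner_turned]
      ring
    · rw [turned_mem_contactPlane (hφ t)]
      simp
    · rw [hderiv]
      refine hasRotationNumber_of_slit (α := fun _ => 0) (ρ := fun _ => 1) (c₁ := fun _ => 1)
        (c₂ := fun _ => 0) (fun t => ⟨?_, hk, ?_⟩)
        (fun _ => one_pos) continuous_const continuous_const continuous_const (fun _ => rfl)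
        (fun _ => rfl) (fun t => by simp) (fun t => by simp) (fun t l hl h => ?_)
      · exact fun h => hc0 (turned_eq_zero.1 h).1
      · rw [inner_turned]
        ring
      · rw [Real.cos_zero] at h
        linarith
  · refine ⟨fun _ => turned ψ 0 0 1, _, _, _, linearIndependent_map_pair M, hS, continuousOn_const,
      fun z _ => ⟨hk, ?_, rfl⟩, fun z _ => ?_, ?_⟩
    · rw [turned_mem_contactPlane (ψ := ψ) (φ := 2 * Real.pi * n * z 2 - ψ) (by ring)]
      simp
    · refine Submodule.subset_span (Or.inr ?_)
      rw [hM', zero_mul, Set.mem_singleton_iff]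
    · have hN : ‖turned ψ 0 1 0‖ = 1 := by
        rw [norm_eq_sqrt_real_inner, inner_turned, Real.sqrt_eq_one]
        ring
      simp only [contactNormal_eq_turned (hφ _), hderiv, Real.cos_pi_div_two, Real.sin_pi_div_two]
      -- The velocity is constantly c times Z turned by a right angle, so only c ≠ 0 is needed.
      refine hasRotationNumber_of_slit (α := fun _ => 0) (ρ := fun _ => 1) (c₁ := fun _ => 0)
        (c₂ := fun _ => c) (fun t => ⟨?_, hk, ?_⟩)
        (fun _ => one_pos) continuous_const continuous_const continuous_const (fun _ => rfl)
        (fun _ => rfl) (fun t => by simp) (fun t => ?_) (fun t l hl h => ?_)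
      · rw [← norm_ne_zero_iff, hN]
        exact one_ne_zero
      · rw [inner_turned]
        ring
      · rw [hN, inv_one, one_smul, one_smul, cross3_turned, smul_turned, smul_turned, turned_add]
        congr 1 <;> ring
      · rwa [Real.sin_zero, mul_zero]

end

theorem mainTheorem5 (n : ℕ) (hn : 0 < n) (p q r : ℤ)
    (hprim : Int.gcd (Int.gcd p q : ℤ) r = 1) :
    ∃ (α : UnitAddCircle → Torus3) (γ : ℝ → E3),
      IsTorusKnot α ∧ IsLegendrian n α ∧ IsQuasilinear α ∧
      IsLift γ α ∧ (∀ t, γ (t + 1) = γ t + intVec p q r) ∧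
      ∃ (S : Set E3) (tb rot χ : ℤ),
        IsCoveringSeifertSurface γ (intVec p q r) S ∧
        HasThurstonBennequin n γ S tb ∧
        HasMaslovNumber n γ (intVec p q r) S rot ∧
        HasEulerCharacteristic (seifertQuotient (intVec p q r) S) χ ∧
        tb + rot = -χ + |r| * n ∧
        rot = 0 ∧ tb = |r| * n ∧ χ = 0 := by
  by_cases hr : r = 0
  · exact exists_legendrian_of_height_eq_zero n hn hr hprim
  · exact exists_legendrian_of_height_ne_zero n hn hr hprim
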